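/- **Network and faults.** Let $\mathcal G=(\mathcal C,\mathcal E)$ be a finite connected graph, $f\ge 0$ and $m\ge 3f+1$. The network $G=(V,E)$ replaces each $C\in\mathcal C$ by a clique of $m$ nodes (the cluster $C$) and each edge of $\mathcal G$ by a complete bipartite graph between the two clusters. $D$ is the hop diameter of $G$ (which is that of $\mathcal G$ if $|\mathcal C|\ge 2$). A set $F\subseteq V$ with at most $f$ nodes in each cluster is faulty (Byzantine: everything received from a faulty node is arbitrary). A message sent by a correct node at time $p$ is received by each neighbor (and by the sender itself) in $[p+d-U,p+d]$, where $0\le U<d$. A correct node $v$ has a locally integrable hardware clock rate $h_v:\mathbb R\to[1,1+\rho]$, and logical clock $$L_v(t)=\int_0^t(1+\varphi\,\delta_v(\tau))(1+\mu\,\gamma_v(\tau))h_v(\tau)\,d\tau,\qquad \gamma_v\in\{0,1\}.$$ $\gamma_v=1$ is fast mode and $\gamma_v=0$ is slow mode. **Parameters.** $\mu=c_2\rho$, $c_1=\frac{1/2-1/4096}{1+c_2}\cdot\frac1\rho$, $\varphi=1/c_1$, $\vartheta_g=(1+\rho)(1+\mu)$, $\zeta_{\max}=(1+\varphi)(1+\mu)$,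 $\gamma=(1+\mu)(\vartheta_g-1)$, $\alpha=\frac{2\vartheta_g^2+5\vartheta_g-5}{2(\vartheta_g+1)(1-\gamma)}+\frac{\gamma}{1-\gamma}(1+c_1)$, $\beta=\frac{\gamma}{1-\gamma}d+\frac{1}{1-\gamma}\left(3\vartheta_g-1+\gamma c_1\right)U$, $E=\beta/(1-\alpha)$, $\tau_1=\zeta_{\max}\vartheta_gE$, $\tau_2=\zeta_{\max}\vartheta_g(E+d)$, $\tau_3=c_1\zeta_{\max}\vartheta_g(E+U)$, $\delta=(k+5)E$ and $\kappa=3\delta$. **Cluster algorithm.** Each correct $v\in C$ starts at time $0$ and works in rounds of three phases of logical lengths $\tau_1,\tau_2,\tau_3$, measured on $L_v$; round $r$ starts at time $t_v(r)$. It sends a pulse to its neighbors at the end of phase 1, and during phases 1 and 2 it sets $\delta_v=1$ and records for each $w\in C$ the time $t_{wv}$ at which it first receives a pulse of $w$ (arbitrary if it receives none). Let $S_v^1\le\dots\le S_v^m$ be the values $L_v(t_{wv})-L_v(t_{vv})$, $w\in C$, in ascending order, and $\Delta_v=\frac12(S_v^{f+1}+S_v^{m-f})$. In phase 3, $\delta_v=1-(1+\frac1\varphi)\frac{\Delta_v}{\tau_3+\Delta_v}$.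 For each cluster $A$ in the set $N_C$ of clusters adjacent to $C$, $v$ also simulates this algorithm on the pulses received from $A$ without sending pulses (with arbitrary simulated modes; the time at which its own virtual pulse counts as received obeys the delay bounds), and $\widetilde L_A^v$ is the simulated clock. **Triggers.** $v\in C$ satisfies the fast trigger at time $t$ if for some integer $s\ge1$: $\widetilde L_A^v(t)-L_v(t)\ge 2s\kappa-\delta$ for some $A\in N_C$, and $L_v(t)-\widetilde L_B^v(t)\le 2s\kappa+\delta$ for all $B\in N_C$. It satisfies the slow trigger if for some integer $s\ge1$: $L_v(t)-\widetilde L_A^v(t)\ge(2s-1)\kappa-\delta$ for some $A\in N_C$, and $\widetilde L_B^v(t)-L_v(t)\le(2s-1)\kappa+\delta$ for all $B\in N_C$. **Estimates.** Each correct $v$ maintains an estimate $M_v$ of the maximum correct clock: $M_v(0)=0$; $M_v$ grows at rate $h_v/(1+\rho)$; $M_v$ is raised to $L_v$ whenever it would be below; and as soon as $v$ has received $j\ge1$ flooding pulses from each of $f+1$ nodes of some adjacent cluster, $M_v$ is raised to $(j+1)(d-U)$ if this increases it. For each $j\ge1$, $v$ sends its $j$-th flooding pulse (distinguishable from the other pulses,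 with the same delay bounds) to its neighbors when $M_v$ first reaches $j(d-U)$. **Modes.** At the beginning of each round $r$, each correct $v$ chooses its mode for the whole round: fast if the fast trigger holds at $t_v(r)$; otherwise slow if the slow trigger holds; otherwise fast if $L_v(t_v(r))\le M_v(t_v(r))-c\delta$; otherwise slow. **Theorem.** For every $c_2\ge 32$ there are $\rho_0>0$, $k_0\in\mathbb N$ and $c_0$ such that for all integers $k\ge k_0$ and all reals $c\ge c_0$ there is a constant $K$, depending only on $c_2,k,c$, with the following property. For all $0<\rho\le\rho_0$, all $0\le U<d$, all $\mathcal G,f,m,F$ as above and every execution of the algorithm, the global skew is at most $K\delta D$: $$|L_v(t)-L_w(t)|\le K\,\delta\,D\qquad\text{for all } t\ge0 \text{ and all } v,w\in V\setminus F.$$ -/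

import Mathlib

open Set MeasureTheory

namespace FTGCS

noncomputable section

/-! ## Parameters -/

/-- Primitive parameters: hardware clock drift `ρ`, maximal message delay `d`, delay uncertainty `U`,
the speed-up constant `c₂` (`μ = c₂ ρ`), the constant `k` in `δ = (k + 5) E`, and the constant `c`
of the catch-up rule. -/
structure Params where
  ρ : ℝ
  d : ℝ
  U : ℝ
  c₂ : ℝ
  k : ℕ
  c : ℝ

namespace Params

variable (P : Params)

/-- Maximal relative speed-up of the fast mode. -/
def μ : ℝ := P.c₂ * P.ρ

/-- Stretch factor of phase 3. -/
def c₁ : ℝ := (1 / 2 - 1 / 4096) / (1 + P.c₂) * (1 / P.ρ)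

def φ : ℝ := 1 / P.c₁

/-- `ϑ_g`, the ratio between the largest and the smallest nominal rate. -/
def θg : ℝ := (1 + P.ρ) * (1 + P.μ)

/-- `ζ_max`. -/
def ζmax : ℝ := (1 + P.φ) * (1 + P.μ)

/-- `γ = (ζ_max / ζ) (ϑ_g / ϑ) (ϑ - 1)`, for `ζ = 1 + φ` and `ϑ = ϑ_g`. -/
def γg : ℝ := P.ζmax / (1 + P.φ) * (P.θg / P.θg) * (P.θg - 1)

def α : ℝ :=
  (2 * P.θg ^ 2 + 5 * P.θg - 5) / (2 * (P.θg + 1) * (1 - P.γg)) + P.γg / (1 - P.γg) * (1 + P.c₁)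

def β : ℝ :=
  P.γg / (1 - P.γg) * P.d + 1 / (1 - P.γg) * ((3 * P.θg - 1) + P.γg * P.c₁) * P.U

/-- The steady state bound on the pulse diameter of a cluster: the fixed point of `e ↦ α e + β`. -/
def E : ℝ := P.β / (1 - P.α)

/-- Logical durations of the three phases of a round. -/
def τ₁ : ℝ := P.ζmax * P.θg * P.E

def τ₂ : ℝ := P.ζmax * P.θg * (P.E + P.d)

def τ₃ : ℝ := P.c₁ * P.ζmax * P.θg * (P.E + P.U)

def δ : ℝ := (P.k + 5) * P.E

def κ : ℝ := 3 * P.δ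

end Params

/-! ## The network -/

/-- The augmented network: every node of `𝒢` becomes a clique of `m` nodes, every edge of `𝒢` becomes
a complete bipartite graph. The node `(C, i)` belongs to the cluster `C`. -/
def augmented {𝒞 : Type*} (𝒢 : SimpleGraph 𝒞) (m : ℕ) : SimpleGraph (𝒞 × Fin m) where
  Adj v w := 𝒢.Adj v.1 w.1 ∨ (v.1 = w.1 ∧ v ≠ w)
  symm := ⟨fun _ _ h => h.imp (fun h => h.symm) (fun h => ⟨h.1.symm, h.2.symm⟩)⟩
  loopless := ⟨fun v h => h.elim (fun h => 𝒢.loopless.irrefl v.1 h) (fun h => h.2 rfl)⟩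

/-! ## Cluster synchronization -/

/-- The logical clock driven by the hardware rate `h`, the amortization `δ` and the mode `γ`. -/
def logicalClock (P : Params) (h δ γ : ℝ → ℝ) (t : ℝ) : ℝ :=
  ∫ τ in (0 : ℝ)..t, (1 + P.φ * δ τ) * (1 + P.μ * γ τ) * h τ

/-- The `i`-th smallest entry (`1 ≤ i ≤ m`) of the tuple `x`, counted with multiplicity. -/
def orderStat {m : ℕ} (x : Fin m → ℝ) (i : ℕ) : ℝ :=
  if hi : i - 1 < m then x (Tuple.sort x ⟨i - 1, hi⟩) else 0

/-- `t` is the first time from `t₀` on at which the clock `L` has reached the value `x`. -/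
def FirstReach (L : ℝ → ℝ) (t₀ x t : ℝ) : Prop :=
  IsLeast {s | t₀ ≤ s ∧ x ≤ L s} t

/-- `x` is the first of the reception times `arr 0, arr 1, …` in the listening window `[a, b]`; if
nothing is received in the window, then `x` is arbitrary. -/
def Records (arr : ℕ → ℝ) (a b x : ℝ) : Prop :=
  (∃ r, arr r ∈ Icc a b) → IsLeast {t | t ∈ Icc a b ∧ ∃ r, arr r = t} x

/-- The trajectory of one run of the cluster synchronization algorithm at one node, relative to a
cluster of `m` nodes. Rounds are numbered from `0`. -/
structure Run (m : ℕ) where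
  /-- the time at which round `r` begins -/
  start : ℕ → ℝ
  /-- the end of phase 1 of round `r`, when the pulse is sent -/
  pulse : ℕ → ℝ
  /-- the end of phase 2 of round `r`, when the correction is computed -/
  corr : ℕ → ℝ
  /-- the recorded reception time in round `r` of the pulse of the `i`-th cluster member -/
  obs : Fin m → ℕ → ℝ
  /-- the recorded reception time in round `r` of the own pulse -/
  self : ℕ → ℝ
  /-- the amortization variable `δ_v(t)` -/
  amort : ℝ → ℝ
  /-- the mode `γ_v(t)`: `1` is fast and `0` is slow -/
  mode : ℝ → ℝ

namespace Run

variable {m : ℕ} (P : Params) (f : ℕ) (h : ℝ → ℝ) (X : Run m)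

/-- The logical clock of the run, at a node with hardware clock rate `h`. -/
def L : ℝ → ℝ := logicalClock P h X.amort X.mode

/-- The correction `Δ_v(r)`: the midpoint of the `(f+1)`-st and the `(m-f)`-th smallest of the
recorded offsets. -/
def Δ (r : ℕ) : ℝ :=
  (orderStat (fun i => X.L P h (X.obs i r) - X.L P h (X.self r)) (f + 1) +
    orderStat (fun i => X.L P h (X.obs i r) - X.L P h (X.self r)) (m - f)) / 2

/-- The run obeys the cluster synchronization algorithm (apart from the communication). -/
structure Follows : Prop where
  start_zero : X.start 0 = 0
  pulse_at : ∀ r, FirstReach (X.L P h) (X.start r) (X.L P h (X.start r) + P.τ₁) (X.pulse r)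
  corr_at : ∀ r,
    FirstReach (X.L P h) (X.start r) (X.L P h (X.start r) + P.τ₁ + P.τ₂) (X.corr r)
  start_succ : ∀ r,
    FirstReach (X.L P h) (X.start r) (X.L P h (X.start r) + P.τ₁ + P.τ₂ + P.τ₃) (X.start (r + 1))
  amort_early : ∀ r, ∀ t ∈ Ico (X.start r) (X.corr r), X.amort t = 1
  amort_late : ∀ r, ∀ t ∈ Ico (X.corr r) (X.start (r + 1)),
    X.amort t = 1 - (1 + 1 / P.φ) * (X.Δ P f h r / (P.τ₃ + X.Δ P f h r))
  mode_measurable : Measurable X.mode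
  mode_mem : ∀ t, X.mode t = 0 ∨ X.mode t = 1

end Run

/-! ## Executions -/

/-- Everything that happens in the network over time. -/
structure Execution (𝒞 : Type*) (m : ℕ) where
  /-- hardware clock rates -/
  hw : 𝒞 × Fin m → ℝ → ℝ
  /-- the run of the cluster synchronization algorithm of a node in its own cluster -/
  run : 𝒞 × Fin m → Run m
  /-- the simulation by a node of the cluster synchronization algorithm in an adjacent cluster -/
  sim : 𝒞 × Fin m → 𝒞 → Run m
  /-- `arr u v r`: the time at which `v` receives the pulse sent by `u` in its round `r` -/
  arr : 𝒞 × Fin m → 𝒞 × Fin m → ℕ → ℝ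
  /-- the estimates `M_v(t)` of the maximum clock value -/
  M : 𝒞 × Fin m → ℝ → ℝ
  /-- `floodSend v j`: the time at which `v` sends its `(j+1)`-st flooding pulse -/
  floodSend : 𝒞 × Fin m → ℕ → ℝ
  /-- `floodRecv u v j`: the time (`⊤` is never) at which `v` receives the `(j+1)`-st flooding pulse
  of `u` -/
  floodRecv : 𝒞 × Fin m → 𝒞 × Fin m → ℕ → WithTop ℝ

namespace Execution

variable {𝒞 : Type*} {m : ℕ} (X : Execution 𝒞 m) (P : Params) (𝒢 : SimpleGraph 𝒞) (f : ℕ)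

/-- The logical clock `L_v`. -/
def L (v : 𝒞 × Fin m) : ℝ → ℝ := (X.run v).L P (X.hw v)

/-- The estimate of the clock of the cluster `C` computed by an adjacent node `v`. -/
def Lest (v : 𝒞 × Fin m) (C : 𝒞) : ℝ → ℝ := (X.sim v C).L P (X.hw v)

/-- The fast trigger. -/
def FastTrigger (v : 𝒞 × Fin m) (t : ℝ) : Prop :=
  ∃ s : ℕ, 1 ≤ s ∧
    (∃ A, 𝒢.Adj v.1 A ∧ 2 * s * P.κ - P.δ ≤ X.Lest P v A t - X.L P v t) ∧
    (∀ B, 𝒢.Adj v.1 B → X.L P v t - X.Lest P v B t ≤ 2 * s * P.κ + P.δ)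

/-- The slow trigger. -/
def SlowTrigger (v : 𝒞 × Fin m) (t : ℝ) : Prop :=
  ∃ s : ℕ, 1 ≤ s ∧
    (∃ A, 𝒢.Adj v.1 A ∧ (2 * s - 1) * P.κ - P.δ ≤ X.L P v t - X.Lest P v A t) ∧
    (∀ B, 𝒢.Adj v.1 B → X.Lest P v B t - X.L P v t ≤ (2 * s - 1) * P.κ + P.δ)

open Classical in
/-- The mode chosen by `v` at the beginning of a round, at time `t`. -/
def chosenMode (v : 𝒞 × Fin m) (t : ℝ) : ℝ :=
  if X.FastTrigger P 𝒢 v t then 1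
  else if X.SlowTrigger P 𝒢 v t then 0
  else if X.L P v t ≤ X.M v t - P.c * P.δ then 1
  else 0

/-- By time `s`, node `v` has registered `j` flooding pulses each from `f + 1` nodes of some adjacent
cluster. -/
def Registered (v : 𝒞 × Fin m) (j : ℕ) (s : ℝ) : Prop :=
  ∃ A, 𝒢.Adj v.1 A ∧ ∃ I : Finset (Fin m), I.card = f + 1 ∧
    ∀ i ∈ I, (j : ℕ∞) ≤ Set.encard {l | X.floodRecv (A, i) v l ≤ (s : WithTop ℝ)}

/-- The values to which `v` raises its estimate at time `s`: its own clock value (which is `0` at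
time `0`), and `(j+1)(d-U)` once `j ≥ 1` flooding pulses are registered. -/
def raiseTo (v : 𝒞 × Fin m) (s : ℝ) : Set ℝ :=
  {y | y = X.L P v s ∨ ∃ j : ℕ, 1 ≤ j ∧ X.Registered 𝒢 f v j s ∧ y = (j + 1) * (P.d - P.U)}

/-- Between raises the estimate grows at rate `h_v / (1 + ρ)`, and a raise is carried out only if it
increases the estimate. So the estimate at time `t` is the supremum over the raises at times
`s ≤ t`, each increased by the growth during `[s, t]`. -/
def estimateCandidates (v : 𝒞 × Fin m) (t : ℝ) : Set ℝ :=
  {x | ∃ s ∈ Icc 0 t, ∃ y ∈ X.raiseTo P 𝒢 f v s,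
    x = y + (∫ τ in s..t, X.hw v τ) / (1 + P.ρ)}

/-- `X` is an execution of the algorithm in the network built from `𝒢`, with faulty nodes `F`. Nothing
is required of faulty nodes: all that correct nodes receive from them is arbitrary. -/
structure IsValid (F : Set (𝒞 × Fin m)) : Prop where
  hw_loc : ∀ v ∉ F, LocallyIntegrable (X.hw v)
  hw_mem : ∀ v ∉ F, ∀ t, X.hw v t ∈ Icc 1 (1 + P.ρ)
  /-- pulses of correct nodes are delivered within the delay bounds, also to the sender itself -/
  arr_mem : ∀ u ∉ F, ∀ v ∉ F, (u = v ∨ (augmented 𝒢 m).Adj u v) → ∀ r,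
    X.arr u v r ∈ Icc ((X.run u).pulse r + P.d - P.U) ((X.run u).pulse r + P.d)
  /-- correct nodes run the cluster synchronization algorithm in their cluster -/
  run_follows : ∀ v ∉ F, (X.run v).Follows P f (X.hw v)
  run_obs : ∀ v ∉ F, ∀ i, (v.1, i) ∉ F → ∀ r,
    Records (X.arr (v.1, i) v) ((X.run v).start r) ((X.run v).corr r) ((X.run v).obs i r)
  run_self : ∀ v ∉ F, ∀ r, (X.run v).self r = (X.run v).obs v.2 r
  /-- correct nodes simulate the algorithm for adjacent clusters, with arbitrary simulated modes;
  the own pulse, which is not sent, counts as received within the delay bounds -/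
  sim_follows : ∀ v ∉ F, ∀ C, 𝒢.Adj v.1 C → (X.sim v C).Follows P f (X.hw v)
  sim_obs : ∀ v ∉ F, ∀ C, 𝒢.Adj v.1 C → ∀ i, (C, i) ∉ F → ∀ r,
    Records (X.arr (C, i) v) ((X.sim v C).start r) ((X.sim v C).corr r) ((X.sim v C).obs i r)
  sim_self : ∀ v ∉ F, ∀ C, 𝒢.Adj v.1 C → ∀ r,
    (X.sim v C).self r ∈
      Icc ((X.sim v C).pulse r + P.d - P.U) ((X.sim v C).pulse r + P.d)
  /-- modes are chosen at the beginning of each round and kept during the round -/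
  mode_eq : ∀ v ∉ F, ∀ r, ∀ t ∈ Ico ((X.run v).start r) ((X.run v).start (r + 1)),
    (X.run v).mode t = X.chosenMode P 𝒢 v ((X.run v).start r)
  /-- the estimates of the maximum clock value -/
  M_lub : ∀ v ∉ F, ∀ t, 0 ≤ t → IsLUB (X.estimateCandidates P 𝒢 f v t) (X.M v t)
  /-- a flooding pulse is sent whenever the estimate reaches a positive multiple of `d - U` -/
  floodSend_at : ∀ v ∉ F, ∀ j : ℕ,
    FirstReach (X.M v) 0 ((j + 1) * (P.d - P.U)) (X.floodSend v j)
  floodRecv_mem : ∀ u ∉ F, ∀ v ∉ F, (augmented 𝒢 m).Adj u v → ∀ j,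
    ∃ t ∈ Icc (X.floodSend u j + P.d - P.U) (X.floodSend u j + P.d),
      X.floodRecv u v j = (t : WithTop ℝ)

end Execution

end

end FTGCS

/-! The proof compares all clocks with one reference rate, `pace`, and follows the highest and the
lowest correct clock relative to it.

Within a cluster, the midpoint rule is approximate agreement with fault tolerance: one round maps a
pulse spread `e` to at most `α e + β`, so the fixed point `E` bounds the spread in all rounds
(`pulse_succ_sub_le`, `IsCluster.close`). A simulation obeys the same recursion. Hence clocks in a
cluster, and the estimates of its clocks, agree up to `10 E` (`Steady.L_close`), which is small
against `δ`.

A round takes about `c₁ E` of real time, so the difference `μ - ρ` between fast and slow mode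
amounts to almost `E / 2` per round. In a cluster of uniform mode the error of a round is only `e₁`,
a thousandth of `E`. So a cluster in slow mode advances at a rate of at most `pace`, and one in fast
mode at a rate of at least `pace`, up to `20 E` over any time interval (`advance_le_of_slow`,
`le_advance_of_fast`).

A correct node near the maximum clock is slow: no neighbor is far enough ahead for the fast trigger,
and the catch-up rule does not apply, because the estimates `M` never exceed the maximum (`M_le_L`).
By a barrier argument (`le_of_barrier`) the maximum gains at most `δ` on `pace`. A node near the
minimum clock does not satisfy the slow trigger. If the skew is large it is fast by the catch-up
rule, because flooding keeps `M` within `δ D` of the maximum (`L_le_M_add`). So the minimum loses at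
most `δ` on `pace` while the skew stays large.

Counting from the last time at which the skew was at most `(c + 3) δ D`, it has grown by at most `2
δ` (`skew_le`). Of the two triggers, only the existence of a distant neighbor matters. -/

namespace FTGCS

noncomputable section

/-! ### Arithmetic of the parameters, with errors measured by `ε` and `E` -/

namespace Params

/-- The parameter range of the analysis: small drift, nontrivial delays. -/
structure Admissible (P : Params) : Prop where
  c₂_ge : 32 ≤ P.c₂
  ρ_pos : 0 < P.ρ
  drift_small : (1 + P.c₂) * P.ρ ≤ 1 / 1000000
  U_nonneg : 0 ≤ P.U
  U_lt_d : P.U < P.d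

/-- The total relative drift `(1 + c₂) ρ`, the unit of all relative errors. -/
def ε (P : Params) : ℝ := (1 + P.c₂) * P.ρ

/-- The nominal logical duration of a round. -/
def T (P : Params) : ℝ := P.τ₁ + P.τ₂ + P.τ₃

variable {P : Params}

namespace Admissible

lemma d_pos (hP : P.Admissible) : 0 < P.d := hP.U_nonneg.trans_lt hP.U_lt_d

lemma ε_le (hP : P.Admissible) : P.ε ≤ 1 / 1000000 := hP.drift_small

lemma ε_pos (hP : P.Admissible) : 0 < P.ε :=
  mul_pos (by linarith [hP.c₂_ge]) hP.ρ_pos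

lemma ε_eq (_ : P.Admissible) : P.ε = P.μ + P.ρ := by
  unfold ε μ; ring

lemma ρ_le (hP : P.Admissible) : 33 * P.ρ ≤ P.ε := by
  unfold ε; nlinarith [hP.c₂_ge, hP.ρ_pos]

lemma μ_ge (hP : P.Admissible) : 32 * P.ρ ≤ P.μ := by
  linarith [hP.ε_eq, hP.ρ_le]

lemma μ_pos (hP : P.Admissible) : 0 < P.μ := by
  linarith [hP.μ_ge, hP.ρ_pos]

lemma μ_le (hP : P.Admissible) : P.μ ≤ P.ε := by
  linarith [hP.ε_eq, hP.ρ_pos]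

lemma θg_eq (hP : P.Admissible) : P.θg = 1 + P.ε + P.ρ * P.μ := by
  rw [hP.ε_eq]; unfold θg; ring

lemma ρμ_le (hP : P.Admissible) : P.ρ * P.μ ≤ P.ε / 1000000 := by
  nlinarith [hP.ρ_pos, hP.μ_pos, hP.μ_le, hP.ρ_le, hP.ε_le, hP.ε_pos]

lemma θg_ge (hP : P.Admissible) : 1 + P.ε ≤ P.θg := by
  have := mul_pos hP.ρ_pos hP.μ_pos
  linarith [hP.θg_eq]

lemma θg_le (hP : P.Admissible) : P.θg ≤ 1 + P.ε + P.ε / 1000000 := by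
  linarith [hP.θg_eq, hP.ρμ_le]

lemma one_lt_θg (hP : P.Admissible) : 1 < P.θg := by
  linarith [hP.θg_ge, hP.ε_pos]

lemma c₁_eq (hP : P.Admissible) : P.c₁ * P.ε = 2047 / 4096 := by
  have h1 := hP.ρ_pos.ne'
  have h2 : (1 + P.c₂) ≠ 0 := by linarith [hP.c₂_ge]
  unfold c₁ ε; field_simp; norm_num

lemma c₁_pos (hP : P.Admissible) : 0 < P.c₁ := by
  have := hP.c₁_eq
  by_contra h
  nlinarith [hP.ε_pos]

lemma c₁_mul_φ (hP : P.Admissible) : P.c₁ * P.φ = 1 := by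
  have := hP.c₁_pos.ne'
  unfold φ; field_simp

lemma φ_eq (hP : P.Admissible) : 2047 * P.φ = 4096 * P.ε := by
  have h1 := hP.c₁_mul_φ
  have h2 := hP.c₁_eq
  have h3 := hP.c₁_pos
  have : P.c₁ * (2047 * P.φ - 4096 * P.ε) = 0 := by linarith
  rcases mul_eq_zero.1 this with h | h <;> linarith

lemma φ_pos (hP : P.Admissible) : 0 < P.φ := by linarith [hP.φ_eq, hP.ε_pos]

lemma φ_le (hP : P.Admissible) : P.φ ≤ 2.001 * P.ε := by linarith [hP.φ_eq, hP.ε_pos]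

lemma γg_eq (hP : P.Admissible) : P.γg = (1 + P.μ) * (P.θg - 1) := by
  have h1 : 1 + P.φ ≠ 0 := by linarith [hP.φ_pos]
  have h2 : P.θg ≠ 0 := by linarith [hP.one_lt_θg]
  unfold γg ζmax; field_simp

lemma γg_ge (hP : P.Admissible) : P.ε ≤ P.γg := by
  rw [hP.γg_eq]; nlinarith [hP.μ_pos, hP.θg_ge, hP.ε_pos]

lemma γg_le (hP : P.Admissible) : P.γg ≤ 1.00001 * P.ε := by
  rw [hP.γg_eq]; nlinarith [hP.μ_pos, hP.θg_le, hP.ε_pos, hP.μ_le, hP.ε_le, hP.one_lt_θg]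

/-- The main part of `(1 - γ) α`. -/
def contr (P : Params) : ℝ := (2 * P.θg ^ 2 + 5 * P.θg - 5) / (2 * (P.θg + 1))

lemma contr_eq (hP : P.Admissible) :
    contr P = 1 / 2 + (P.θg - 1) * ((P.θg + 3) / (P.θg + 1)) := by
  have h2 : P.θg + 1 ≠ 0 := by linarith [hP.one_lt_θg]
  unfold contr; field_simp; ring

/-- The form `(θg - 1) (1 + 1 / θg)` is the sum of the drift terms `θg - 1` and `1 - 1 / θg` that
the upper and the lower pulse estimates contribute in `pulse_succ_sub_le`. -/
lemma contr_ge (hP : P.Admissible) :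
    1 / 2 + (P.θg - 1) * (1 + 1 / P.θg) ≤ contr P := by
  have h1 := hP.one_lt_θg
  rw [hP.contr_eq]
  have : 1 + 1 / P.θg ≤ (P.θg + 3) / (P.θg + 1) := by
    rw [one_add_div (by linarith), div_le_div_iff₀ (by linarith) (by linarith)]
    nlinarith
  have := mul_le_mul_of_nonneg_left this (by linarith : 0 ≤ P.θg - 1)
  linarith

lemma contr_le (hP : P.Admissible) : contr P ≤ 1 / 2 + 2 * (P.θg - 1) := by
  have h1 := hP.one_lt_θg
  rw [hP.contr_eq]
  have : (P.θg + 3) / (P.θg + 1) ≤ 2 := by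
    rw [div_le_iff₀ (by linarith)]; linarith
  have := mul_le_mul_of_nonneg_left this (by linarith : 0 ≤ P.θg - 1)
  linarith

lemma γg_mul_c₁ (hP : P.Admissible) :
    2047 / 4096 ≤ P.γg * P.c₁ ∧ P.γg * P.c₁ ≤ 1.00001 * (2047 / 4096) := by
  have h1 := mul_le_mul_of_nonneg_right hP.γg_ge hP.c₁_pos.le
  have h2 := mul_le_mul_of_nonneg_right hP.γg_le hP.c₁_pos.le
  have := hP.c₁_eq
  constructor <;> linarith

lemma one_sub_α (hP : P.Admissible) :
    (1 - P.γg) * (1 - P.α) = 1 - contr P - 2 * P.γg - P.γg * P.c₁ := by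
  have h1 : 1 - P.γg ≠ 0 := by linarith [hP.γg_le, hP.ε_le]
  have h2 : P.θg + 1 ≠ 0 := by linarith [hP.one_lt_θg]
  unfold α contr; field_simp; ring

/-- The summands `1/2` and `γg c₁`, about `1/2 - 1/4096`, leave a gap of `1/4096`. All other terms
are multiples of `ε` and too small to close it. -/
lemma gap_bounds (hP : P.Admissible) :
    0 < 1 - contr P - 2 * P.γg - P.γg * P.c₁ ∧
      1 - contr P - 2 * P.γg - P.γg * P.c₁ ≤ 1 / 4096 := by
  have := hP.γg_mul_c₁
  have h1 := hP.one_lt_θg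
  have h2 : 0 ≤ (P.θg - 1) * (1 + 1 / P.θg) := by
    have : 0 ≤ P.θg - 1 := by linarith
    positivity
  have := hP.contr_ge
  have := hP.contr_le
  have := hP.γg_le
  have := hP.γg_ge
  have := hP.θg_le
  have := hP.ε_le
  have := hP.ε_pos
  constructor
  · norm_num at *; linarith
  · linarith

/-- The defining fixed point equation of `E`, with denominators cleared. -/
lemma E_fixed (hP : P.Admissible) :
    (1 - contr P - 2 * P.γg - P.γg * P.c₁) * P.E =
      P.γg * P.d + (3 * P.θg - 1 + P.γg * P.c₁) * P.U := by
  have h1 : 1 - P.γg ≠ 0 := by linarith [hP.γg_le, hP.ε_le]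
  have h0 := hP.gap_bounds.1
  have h2 : 1 - P.α ≠ 0 := by
    intro h; rw [← hP.one_sub_α, h] at h0; simp at h0
  rw [← hP.one_sub_α]
  unfold E β
  field_simp

/-- The gap multiplying `E` in `E_fixed` is at most `1/4096`, so `E` exceeds the one-round errors `ε
d` and `U` by a large factor. The coefficient of `U` is at least `2 + 2047/4096`. -/
lemma E_lower (hP : P.Admissible) : 4096 * (P.ε * P.d + 2.49 * P.U) ≤ P.E := by
  have h := hP.E_fixed
  have h0 := hP.gap_bounds
  have h1 : P.ε * P.d ≤ P.γg * P.d := mul_le_mul_of_nonneg_right hP.γg_ge hP.d_pos.le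
  have h2 : 2.49 * P.U ≤ (3 * P.θg - 1 + P.γg * P.c₁) * P.U :=
    mul_le_mul_of_nonneg_right (by have := hP.γg_mul_c₁; have := hP.one_lt_θg; norm_num at *; linarith)
      hP.U_nonneg
  have h3 : 0 < P.ε * P.d := mul_pos hP.ε_pos hP.d_pos
  have hU := hP.U_nonneg
  have h4 : 0 < P.E := by
    by_contra hE
    nlinarith
  nlinarith

lemma E_pos (hP : P.Admissible) : 0 < P.E := by
  have h3 : 0 < P.ε * P.d := mul_pos hP.ε_pos hP.d_pos
  have hU := hP.U_nonneg
  linarith [hP.E_lower]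

lemma ε_mul_d_le (hP : P.Admissible) : 4096 * (P.ε * P.d) ≤ P.E := by
  have hU := hP.U_nonneg
  linarith [hP.E_lower]

lemma U_le (hP : P.Admissible) : 10000 * P.U ≤ P.E := by
  have h3 : 0 < P.ε * P.d := mul_pos hP.ε_pos hP.d_pos
  have hU := hP.U_nonneg
  linarith [hP.E_lower]

lemma one_add_φ_pos (hP : P.Admissible) : 0 < 1 + P.φ := by linarith [hP.φ_pos]

lemma τ₁_eq (_ : P.Admissible) : P.τ₁ = (1 + P.φ) * ((1 + P.μ) * P.θg * P.E) := by
  unfold τ₁ ζmax; ring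

lemma τ₂_eq (_ : P.Admissible) : P.τ₂ = (1 + P.φ) * ((1 + P.μ) * P.θg * (P.E + P.d)) := by
  unfold τ₂ ζmax; ring

lemma τ₃_eq (_ : P.Admissible) :
    P.τ₃ = (1 + P.φ) * ((1 + P.μ) * P.θg * (P.c₁ * (P.E + P.U))) := by
  unfold τ₃ ζmax; ring

lemma T_eq (hP : P.Admissible) :
    P.T = (1 + P.φ) * ((1 + P.μ) * P.θg * (2 * P.E + P.d + P.c₁ * (P.E + P.U))) := by
  unfold T; rw [hP.τ₁_eq, hP.τ₂_eq, hP.τ₃_eq]; ring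

lemma stretch_pos (hP : P.Admissible) : 0 < (1 + P.μ) * P.θg :=
  mul_pos (by linarith [hP.μ_pos]) (by linarith [hP.one_lt_θg])

lemma τ₁_pos (hP : P.Admissible) : 0 < P.τ₁ := by
  rw [hP.τ₁_eq]
  exact mul_pos hP.one_add_φ_pos (mul_pos hP.stretch_pos hP.E_pos)

lemma τ₂_pos (hP : P.Admissible) : 0 < P.τ₂ := by
  rw [hP.τ₂_eq]
  exact mul_pos hP.one_add_φ_pos (mul_pos hP.stretch_pos (by linarith [hP.E_pos, hP.d_pos]))

lemma τ₃_pos (hP : P.Admissible) : 0 < P.τ₃ := by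
  rw [hP.τ₃_eq]
  exact mul_pos hP.one_add_φ_pos (mul_pos hP.stretch_pos
    (mul_pos hP.c₁_pos (by linarith [hP.E_pos, hP.U_nonneg])))

lemma T_pos (hP : P.Admissible) : 0 < P.T := by
  have := hP.τ₁_pos; have := hP.τ₂_pos; have := hP.τ₃_pos
  unfold T; linarith

lemma φ_mul_τ₃ (hP : P.Admissible) :
    P.φ * P.τ₃ = (1 + P.φ) * ((1 + P.μ) * P.θg * (P.E + P.U)) := by
  rw [hP.τ₃_eq]
  linear_combination (1 + P.φ) * ((1 + P.μ) * P.θg * (P.E + P.U)) * hP.c₁_mul_φ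

/-- Phase 3 dominates the round, and `c₁ ε` is almost `1/2`: the drift of one round is about `E /
2`. -/
lemma ε_mul_T_le (hP : P.Admissible) : P.ε * P.T ≤ 0.6 * P.E := by
  have h1 : P.ε * P.T = ((1 + P.φ) * ((1 + P.μ) * P.θg)) *
      (2 * (P.ε * P.E) + P.ε * P.d + (2047 / 4096) * (P.E + P.U)) := by
    rw [hP.T_eq, ← hP.c₁_eq]; ring
  have hE := hP.E_pos
  have h2 : P.ε * P.E ≤ P.E / 1000000 := by nlinarith [hP.ε_le]
  have h3 := hP.ε_mul_d_le
  have h4 := hP.U_le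
  have h5 : (2 * (P.ε * P.E) + P.ε * P.d + (2047 / 4096) * (P.E + P.U)) ≤ 0.51 * P.E := by
    norm_num at *; linarith
  have h6 : (1 + P.μ) * P.θg ≤ 1.01 := by
    nlinarith [hP.μ_pos, hP.θg_le, hP.μ_le, hP.ε_le, hP.one_lt_θg, hP.ε_pos]
  have h7 : (1 + P.φ) * ((1 + P.μ) * P.θg) ≤ 1.01 * 1.01 :=
    mul_le_mul (by norm_num; linarith [hP.φ_le, hP.ε_le]) h6 hP.stretch_pos.le (by norm_num)
  rw [h1]
  have h8 : 0 ≤ P.ε * P.E := mul_nonneg hP.ε_pos.le hE.le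
  have h9 : 0 ≤ P.ε * P.d := mul_nonneg hP.ε_pos.le hP.d_pos.le
  have h10 := hP.U_nonneg
  calc _ ≤ (1.01 * 1.01) * (0.51 * P.E) :=
        mul_le_mul h7 h5 (by linarith) (by norm_num)
    _ ≤ _ := by norm_num; linarith

end Admissible

end Params

/-! ### The round duration and the rate separating fast clusters from slow ones -/

namespace Params

/-- The error made in one round by a cluster whose members all have the same mode. -/
def e₁ (P : Params) : ℝ := P.U + (P.θg - 1) * (P.E + P.U)

/-- A round duration separating fast clusters from slow ones. -/
def period (P : Params) : ℝ := P.T / ((1 + P.φ) * (1 + P.μ)) + P.e₁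

/-- The clock rate separating fast clusters from slow ones. -/
def pace (P : Params) : ℝ := P.T / P.period

variable {P : Params}

namespace Admissible

lemma e₁_nonneg (hP : P.Admissible) : 0 ≤ P.e₁ := by
  have := hP.one_lt_θg
  have := mul_nonneg (by linarith : 0 ≤ P.θg - 1)
    (by linarith [hP.E_pos, hP.U_nonneg] : 0 ≤ P.E + P.U)
  unfold e₁; linarith [hP.U_nonneg]

lemma e₁_le (hP : P.Admissible) : P.e₁ ≤ 0.001 * P.E := by
  have h := hP.U_le
  have hE := hP.E_pos
  have hU := hP.U_nonneg
  have h1 : P.θg - 1 ≤ 1 / 100000 := by linarith [hP.θg_le, hP.ε_le]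
  have := mul_le_mul_of_nonneg_right h1 (by linarith : 0 ≤ P.E + P.U)
  unfold e₁; norm_num at *; linarith

lemma period_pos (hP : P.Admissible) : 0 < P.period := by
  have := hP.e₁_nonneg
  have := div_pos hP.T_pos (mul_pos hP.one_add_φ_pos (by linarith [hP.μ_pos] : 0 < 1 + P.μ))
  unfold period; linarith

/-- The nominal durations of a slow and a fast round differ by about `(μ - ρ) c₁ E`, nearly `0.47 E`
because `μ ≥ 32 ρ`. This leaves room for an error `e₁` on both sides. -/
lemma period_le_slow (hP : P.Admissible) :
    P.period ≤ P.T / ((1 + P.φ) * (1 + P.ρ)) - P.e₁ := by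
  have hn := hP.one_add_φ_pos
  have hμ := hP.μ_pos
  have hρ := hP.ρ_pos
  set X := 2 * P.E + P.d + P.c₁ * (P.E + P.U) with hX
  have h1 : P.T / ((1 + P.φ) * (1 + P.μ)) = P.θg * X := by
    rw [hP.T_eq, ← hX]; field_simp
  have h2 : P.T / ((1 + P.φ) * (1 + P.ρ)) = (1 + P.μ) ^ 2 * X := by
    rw [hP.T_eq, ← hX]; unfold θg; field_simp
  have h3 : (1 + P.μ) ^ 2 * X - P.θg * X = (1 + P.μ) * ((P.μ - P.ρ) * X) := by
    unfold θg; ring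
  have hE := hP.E_pos
  have hU := hP.U_nonneg
  have hXc : P.c₁ * P.E ≤ X := by
    have := mul_nonneg hP.c₁_pos.le hU
    rw [hX]; linarith [hP.d_pos]
  have hcE := mul_pos hP.c₁_pos hE
  have h4 : 31 / 33 * P.ε ≤ P.μ - P.ρ := by linarith [hP.ρ_le, hP.ε_eq]
  have h5 : 31 / 33 * P.ε * (P.c₁ * P.E) ≤ (P.μ - P.ρ) * X :=
    mul_le_mul h4 hXc hcE.le (by linarith [hP.ε_pos])
  have h6 : 31 / 33 * P.ε * (P.c₁ * P.E) = 31 / 33 * (2047 / 4096) * P.E := by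
    rw [← hP.c₁_eq]; ring
  have h7 : (P.μ - P.ρ) * X ≤ (1 + P.μ) * ((P.μ - P.ρ) * X) := by
    have : 0 ≤ (P.μ - P.ρ) * X := by linarith
    nlinarith
  have := hP.e₁_le
  unfold period
  rw [h1, h2]
  norm_num at *
  linarith

lemma period_le_T (hP : P.Admissible) : P.period ≤ P.T := by
  have hn : 1 ≤ (1 + P.φ) * (1 + P.ρ) := by nlinarith [hP.φ_pos, hP.ρ_pos]
  have := div_le_self hP.T_pos.le hn
  linarith [hP.period_le_slow, hP.e₁_nonneg]

lemma one_le_pace (hP : P.Admissible) : 1 ≤ P.pace := by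
  unfold pace; rw [le_div_iff₀ hP.period_pos]; linarith [hP.period_le_T]

/-- The factor `1 - φ` is the worst case of phase 3, where the correction is `-φ τ₃`. Two
contributions of `φ`, about `2 ε` each, and one of `θg - 1`, about `ε`, fit into `6 ε`. -/
lemma rate_le (hP : P.Admissible) : (1 + P.φ) * P.θg ≤ (1 + 6 * P.ε) * (1 - P.φ) := by
  nlinarith [hP.φ_pos, hP.φ_le, hP.θg_le, hP.one_lt_θg, hP.ε_le, hP.ε_pos]

lemma nominal_le (hP : P.Admissible) : (1 + P.φ) * P.θg ≤ 1 + 6 * P.ε := by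
  nlinarith [hP.rate_le, hP.φ_pos, hP.ε_pos]

lemma pace_le (hP : P.Admissible) : P.pace ≤ 1 + 6 * P.ε := by
  have hn := mul_pos hP.one_add_φ_pos (by linarith [hP.μ_pos] : 0 < 1 + P.μ)
  have h : P.T ≤ ((1 + P.φ) * (1 + P.μ)) * P.period := by
    have := mul_nonneg hn.le hP.e₁_nonneg
    unfold period
    rw [mul_add, mul_div_cancel₀ _ hn.ne']; linarith
  have h2 : (1 + P.φ) * (1 + P.μ) ≤ 1 + 6 * P.ε := by
    refine le_trans (mul_le_mul_of_nonneg_left ?_ hP.one_add_φ_pos.le) hP.nominal_le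
    linarith [hP.θg_ge, hP.μ_le]
  unfold pace
  rw [div_le_iff₀ hP.period_pos]
  exact h.trans (mul_le_mul_of_nonneg_right h2 hP.period_pos.le)

lemma pace_mul_period (hP : P.Admissible) : P.pace * P.period = P.T := by
  unfold pace; rw [div_mul_cancel₀ _ hP.period_pos.ne']

end Admissible

end Params

/-! ## A single run -/

namespace Run

variable {m : ℕ}

/-- The clock without amortization. -/
def base (P : Params) (h : ℝ → ℝ) (Y : Run m) (t : ℝ) : ℝ :=
  ∫ τ in (0 : ℝ)..t, (1 + P.μ * Y.mode τ) * h τ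

/-- A run of the algorithm, driven by an admissible hardware clock. -/
structure Driven (P : Params) (f : ℕ) (h : ℝ → ℝ) (Y : Run m) : Prop where
  adm : P.Admissible
  loc : LocallyIntegrable h
  mem : ∀ t, h t ∈ Icc 1 (1 + P.ρ)
  follows : Y.Follows P f h

variable {P : Params} {f : ℕ} {h : ℝ → ℝ} {Y : Run m}

namespace Driven

lemma mode_nonneg (H : Driven P f h Y) (t : ℝ) : 0 ≤ Y.mode t := by
  rcases H.follows.mode_mem t with h | h <;> rw [h]; norm_num

lemma mode_le (H : Driven P f h Y) (t : ℝ) : Y.mode t ≤ 1 := by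
  rcases H.follows.mode_mem t with h | h <;> rw [h]; norm_num

lemma base_intervalIntegrable (H : Driven P f h Y) (a b : ℝ) :
    IntervalIntegrable (fun τ => (1 + P.μ * Y.mode τ) * h τ) volume a b := by
  have h1 : IntervalIntegrable h volume a b := (H.loc.integrableOn_isCompact isCompact_uIcc).intervalIntegrable
  rw [intervalIntegrable_iff] at h1 ⊢
  refine h1.bdd_mul (c := 1 + P.μ) ?_ ?_
  · exact ((H.follows.mode_measurable.const_mul _).const_add _).aestronglyMeasurable
  · filter_upwards with t
    have := H.mode_nonneg t
    have := H.mode_le t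
    have := H.adm.μ_pos
    rw [Real.norm_eq_abs, abs_of_nonneg (by positivity)]
    nlinarith

lemma base_sub (H : Driven P f h Y) (a b : ℝ) :
    Y.base P h b - Y.base P h a = ∫ τ in a..b, (1 + P.μ * Y.mode τ) * h τ :=
  intervalIntegral.integral_interval_sub_left (H.base_intervalIntegrable _ _)
    (H.base_intervalIntegrable _ _)

lemma base_ge_of_le (H : Driven P f h Y) {a b r : ℝ} (hab : a ≤ b)
    (hr : ∀ t ∈ Ico a b, r ≤ (1 + P.μ * Y.mode t) * h t) :
    r * (b - a) ≤ Y.base P h b - Y.base P h a := by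
  rw [H.base_sub]
  have : r * (b - a) = ∫ τ in a..b, r := by simp [mul_comm]
  rw [this]
  refine intervalIntegral.integral_mono_on_of_le_Ioo hab (by simp) (H.base_intervalIntegrable _ _) ?_
  exact fun t ht => hr t ⟨ht.1.le, ht.2⟩

lemma base_le_of_le (H : Driven P f h Y) {a b r : ℝ} (hab : a ≤ b)
    (hr : ∀ t ∈ Ico a b, (1 + P.μ * Y.mode t) * h t ≤ r) :
    Y.base P h b - Y.base P h a ≤ r * (b - a) := by
  rw [H.base_sub]
  have : r * (b - a) = ∫ τ in a..b, r := by simp [mul_comm]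
  rw [this]
  refine intervalIntegral.integral_mono_on_of_le_Ioo hab (H.base_intervalIntegrable _ _) (by simp) ?_
  exact fun t ht => hr t ⟨ht.1.le, ht.2⟩

lemma base_ge (H : Driven P f h Y) {a b : ℝ} (hab : a ≤ b) :
    b - a ≤ Y.base P h b - Y.base P h a := by
  have := H.base_ge_of_le (r := 1) hab fun t _ => by
    have := mul_nonneg H.adm.μ_pos.le (H.mode_nonneg t)
    nlinarith [(H.mem t).1]
  linarith

lemma base_le (H : Driven P f h Y) {a b : ℝ} (hab : a ≤ b) :
    Y.base P h b - Y.base P h a ≤ P.θg * (b - a) := by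
  refine H.base_le_of_le hab fun t _ => ?_
  have h1 := mul_le_mul_of_nonneg_left (H.mode_le t) H.adm.μ_pos.le
  have h2 := mul_nonneg H.adm.μ_pos.le (H.mode_nonneg t)
  have h3 := H.mem t
  unfold Params.θg
  rw [mul_comm (1 + P.ρ)]
  exact mul_le_mul (by linarith) h3.2 (by linarith [h3.1]) (by linarith [H.adm.μ_pos])

lemma base_le_slow (H : Driven P f h Y) {a b : ℝ} (hab : a ≤ b)
    (hs : ∀ t ∈ Ico a b, Y.mode t = 0) :
    Y.base P h b - Y.base P h a ≤ (1 + P.ρ) * (b - a) := by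
  refine H.base_le_of_le hab fun t ht => ?_
  rw [hs t ht]; simpa using (H.mem t).2

lemma base_ge_fast (H : Driven P f h Y) {a b : ℝ} (hab : a ≤ b)
    (hs : ∀ t ∈ Ico a b, Y.mode t = 1) :
    (1 + P.μ) * (b - a) ≤ Y.base P h b - Y.base P h a := by
  refine H.base_ge_of_le hab fun t ht => ?_
  rw [hs t ht, mul_one]
  nlinarith [(H.mem t).1, H.adm.μ_pos]

lemma base_continuous (H : Driven P f h Y) : Continuous (Y.base P h) := by
  apply intervalIntegral.continuous_primitive
  exact fun a b => H.base_intervalIntegrable a b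

/-- The integrand of the logical clock. -/
def integrand (P : Params) (h : ℝ → ℝ) (Y : Run m) (τ : ℝ) : ℝ :=
  (1 + P.φ * Y.amort τ) * (1 + P.μ * Y.mode τ) * h τ

/-- Measurability of `amort` is not assumed. It is constant on each half-open phase, which gives
integrability and a closed form; the right endpoint is a null set. -/
lemma integrand_piece (H : Driven P f h Y) {a b c : ℝ} (hab : a ≤ b)
    (hc : ∀ t ∈ Ico a b, Y.amort t = c) :
    IntervalIntegrable (integrand P h Y) volume a b ∧
      ∫ τ in a..b, integrand P h Y τ = (1 + P.φ * c) * (Y.base P h b - Y.base P h a) := by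
  have key : ∀ t ∈ Ico a b, integrand P h Y t = (1 + P.φ * c) * ((1 + P.μ * Y.mode t) * h t) := by
    intro t ht; unfold integrand; rw [hc t ht, mul_assoc]
  have key' : ∀ᵐ t ∂volume, t ∈ uIoc a b →
      (1 + P.φ * c) * ((1 + P.μ * Y.mode t) * h t) = integrand P h Y t := by
    have : ∀ᵐ t ∂volume, t ≠ b := by simp [ae_iff, measure_singleton]
    filter_upwards [this] with t htb ht
    rw [uIoc_of_le hab] at ht
    exact (key t ⟨ht.1.le, lt_of_le_of_ne ht.2 htb⟩).symm
  constructor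
  · refine ((H.base_intervalIntegrable a b).const_mul (1 + P.φ * c)).congr_ae ?_
    exact (ae_restrict_iff' measurableSet_uIoc).2 key'
  · rw [H.base_sub, ← intervalIntegral.integral_const_mul]
    exact (intervalIntegral.integral_congr_ae key').symm

/-- The value of the amortization variable in phase 3. -/
def late (P : Params) (f : ℕ) (h : ℝ → ℝ) (Y : Run m) (r : ℕ) : ℝ :=
  1 - (1 + 1 / P.φ) * (Y.Δ P f h r / (P.τ₃ + Y.Δ P f h r))

lemma start_le_pulse (H : Driven P f h Y) (r : ℕ) : Y.start r ≤ Y.pulse r :=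
  (H.follows.pulse_at r).1.1

lemma pulse_le_corr (H : Driven P f h Y) (r : ℕ) : Y.pulse r ≤ Y.corr r := by
  have h1 := (H.follows.corr_at r).1
  exact (H.follows.pulse_at r).2 ⟨h1.1, by linarith [h1.2, H.adm.τ₂_pos]⟩

lemma corr_le_start (H : Driven P f h Y) (r : ℕ) : Y.corr r ≤ Y.start (r + 1) := by
  have h1 := (H.follows.start_succ r).1
  exact (H.follows.corr_at r).2 ⟨h1.1, by linarith [h1.2, H.adm.τ₃_pos]⟩

lemma start_le_corr (H : Driven P f h Y) (r : ℕ) : Y.start r ≤ Y.corr r :=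
  (H.start_le_pulse r).trans (H.pulse_le_corr r)

lemma integrable_start (H : Driven P f h Y) (r : ℕ) :
    IntervalIntegrable (integrand P h Y) volume 0 (Y.start r) := by
  induction r with
  | zero => rw [H.follows.start_zero]
  | succ r ih =>
    exact (ih.trans (H.integrand_piece (H.start_le_corr r) (H.follows.amort_early r)).1).trans
      (H.integrand_piece (H.corr_le_start r) (H.follows.amort_late r)).1

lemma L_sub_start (H : Driven P f h Y) (r : ℕ) {t : ℝ} (h1 : Y.start r ≤ t) (h2 : t ≤ Y.corr r) :
    Y.L P h t - Y.L P h (Y.start r) =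
      (1 + P.φ) * (Y.base P h t - Y.base P h (Y.start r)) := by
  have := H.integrand_piece (c := 1) h1 fun x hx => H.follows.amort_early r x ⟨hx.1, hx.2.trans_le h2⟩
  rw [mul_one] at this
  rw [← this.2]
  exact intervalIntegral.integral_interval_sub_left ((H.integrable_start r).trans this.1)
    (H.integrable_start r)

lemma L_sub_corr (H : Driven P f h Y) (r : ℕ) {t : ℝ} (h1 : Y.corr r ≤ t)
    (h2 : t ≤ Y.start (r + 1)) :
    Y.L P h t - Y.L P h (Y.corr r) =
      (1 + P.φ * late P f h Y r) * (Y.base P h t - Y.base P h (Y.corr r)) := by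
  have := H.integrand_piece h1
    fun x hx => H.follows.amort_late r x ⟨hx.1, hx.2.trans_le h2⟩
  have h0 := (H.integrable_start r).trans
    (H.integrand_piece (H.start_le_corr r) (H.follows.amort_early r)).1
  unfold late
  rw [← this.2]
  exact intervalIntegral.integral_interval_sub_left (h0.trans this.1) h0

lemma L_continuousOn (H : Driven P f h Y) (r : ℕ) :
    ContinuousOn (Y.L P h) (Icc (Y.start r) (Y.start (r + 1))) := by
  rw [← Icc_union_Icc_eq_Icc (H.start_le_corr r) (H.corr_le_start r)]
  refine ContinuousOn.union_of_isClosed ?_ ?_ isClosed_Icc isClosed_Icc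
  · have : ContinuousOn (fun t => Y.L P h (Y.start r) +
        (1 + P.φ) * (Y.base P h t - Y.base P h (Y.start r))) (Icc (Y.start r) (Y.corr r)) :=
      (((H.base_continuous.sub continuous_const).const_mul _).const_add _).continuousOn
    exact this.congr fun t ht => by linarith [H.L_sub_start r ht.1 ht.2]
  · have : ContinuousOn (fun t => Y.L P h (Y.corr r) +
        (1 + P.φ * late P f h Y r) * (Y.base P h t - Y.base P h (Y.corr r)))
        (Icc (Y.corr r) (Y.start (r + 1))) :=
      (((H.base_continuous.sub continuous_const).const_mul _).const_add _).continuousOn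
    exact this.congr fun t ht => by linarith [H.L_sub_corr r ht.1 ht.2]

/-- If the clock overshot `y` at the first reaching time, then by continuity it would have attained
`y` earlier. -/
lemma firstReach_exact {L : ℝ → ℝ} {a b y t : ℝ} (hL : ContinuousOn L (Icc a b)) (htb : t ≤ b)
    (ht : FirstReach L a y t) (hy : L a ≤ y) : L t = y := by
  refine le_antisymm ?_ ht.1.2
  by_contra hlt
  push Not at hlt
  have hat := ht.1.1
  obtain ⟨x, hx, hxy⟩ := intermediate_value_Icc hat (hL.mono (Icc_subset_Icc_right htb))
    (⟨hy, hlt.le⟩ : y ∈ Icc (L a) (L t))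
  have := ht.2 ⟨hx.1, hxy.ge⟩
  have : x = t := le_antisymm hx.2 this
  rw [this] at hxy
  linarith

lemma L_pulse_sub (H : Driven P f h Y) (r : ℕ) :
    Y.L P h (Y.pulse r) = Y.L P h (Y.start r) + P.τ₁ :=
  firstReach_exact (H.L_continuousOn r) ((H.pulse_le_corr r).trans (H.corr_le_start r))
    (H.follows.pulse_at r) (by linarith [H.adm.τ₁_pos])

lemma L_corr_sub (H : Driven P f h Y) (r : ℕ) :
    Y.L P h (Y.corr r) = Y.L P h (Y.start r) + P.τ₁ + P.τ₂ :=
  firstReach_exact (H.L_continuousOn r) (H.corr_le_start r)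
    (H.follows.corr_at r) (by linarith [H.adm.τ₁_pos, H.adm.τ₂_pos])

lemma L_succ_sub (H : Driven P f h Y) (r : ℕ) :
    Y.L P h (Y.start (r + 1)) = Y.L P h (Y.start r) + P.T := by
  rw [firstReach_exact (H.L_continuousOn r) le_rfl
    (H.follows.start_succ r) (by linarith [H.adm.τ₁_pos, H.adm.τ₂_pos, H.adm.τ₃_pos])]
  unfold Params.T; ring

lemma L_zero (P : Params) (h : ℝ → ℝ) (Y : Run m) : Y.L P h 0 = 0 := by
  unfold Run.L logicalClock; simp

lemma L_start (H : Driven P f h Y) (r : ℕ) : Y.L P h (Y.start r) = r * P.T := by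
  induction r with
  | zero => rw [H.follows.start_zero, L_zero]; simp
  | succ r ih => rw [H.L_succ_sub, ih]; push_cast; ring

lemma L_pulse (H : Driven P f h Y) (r : ℕ) : Y.L P h (Y.pulse r) = r * P.T + P.τ₁ := by
  rw [H.L_pulse_sub, H.L_start]

lemma base_pulse (H : Driven P f h Y) (r : ℕ) :
    (1 + P.φ) * (Y.base P h (Y.pulse r) - Y.base P h (Y.start r)) = P.τ₁ := by
  rw [← H.L_sub_start r (H.start_le_pulse r) (H.pulse_le_corr r), H.L_pulse_sub]; ring

lemma base_corr (H : Driven P f h Y) (r : ℕ) :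
    (1 + P.φ) * (Y.base P h (Y.corr r) - Y.base P h (Y.pulse r)) = P.τ₂ := by
  have := H.L_sub_start r (H.start_le_corr r) le_rfl
  have := H.base_pulse r
  have := H.L_corr_sub r
  linarith

/-- Phase 3 has nominal duration `τ₃ + Δ`. -/
lemma base_late (H : Driven P f h Y) (r : ℕ) (hΔ : 0 < P.τ₃ + Y.Δ P f h r) :
    (1 + P.φ) * (Y.base P h (Y.start (r + 1)) - Y.base P h (Y.corr r)) = P.τ₃ + Y.Δ P f h r := by
  have h1 := H.L_sub_corr r (H.corr_le_start r) le_rfl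
  rw [H.L_succ_sub, H.L_corr_sub] at h1
  have h2 : P.φ ≠ 0 := H.adm.φ_pos.ne'
  -- The amortization turns the factor `1 + φ` into `(1 + φ) τ₃ / (τ₃ + Δ)`, so that the logical
  -- length `τ₃` takes nominal length `τ₃ + Δ`.
  have h3 : (1 + P.φ * late P f h Y r) * (P.τ₃ + Y.Δ P f h r) = (1 + P.φ) * P.τ₃ := by
    unfold late; field_simp; ring
  have h4 : P.τ₃ = (1 + P.φ * late P f h Y r) *
      (Y.base P h (Y.start (r + 1)) - Y.base P h (Y.corr r)) := by
    rw [← h1]; unfold Params.T; ring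
  have h5 := H.adm.τ₃_pos
  have h6 : (1 + P.φ * late P f h Y r) ≠ 0 := by
    intro h; rw [h] at h4; linarith
  have h7 : (1 + P.φ * late P f h Y r) * ((1 + P.φ) *
      (Y.base P h (Y.start (r + 1)) - Y.base P h (Y.corr r)) - (P.τ₃ + Y.Δ P f h r)) = 0 := by
    linear_combination (-(1 + P.φ)) * h4 - h3
  rcases mul_eq_zero.1 h7 with h | h
  · exact absurd h h6
  · linarith

/-- The nominal time between two consecutive pulses. -/
lemma base_pulse_succ (H : Driven P f h Y) (r : ℕ) (hΔ : 0 < P.τ₃ + Y.Δ P f h r) :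
    (1 + P.φ) * (Y.base P h (Y.pulse (r + 1)) - Y.base P h (Y.pulse r)) =
      P.T + Y.Δ P f h r := by
  have h1 := H.base_late r hΔ
  have h2 := H.base_corr r
  have h3 := H.base_pulse (r + 1)
  unfold Params.T; linarith

lemma corr_lt_start (H : Driven P f h Y) (r : ℕ) : Y.corr r < Y.start (r + 1) := by
  refine lt_of_le_of_ne (H.corr_le_start r) fun h => ?_
  have h1 := H.L_corr_sub r
  have h2 := H.L_succ_sub r
  rw [h, h2] at h1
  unfold Params.T at h1
  linarith [H.adm.τ₃_pos]

/-- Phase 1 is this long so that a pulse sent up to `E` before the own one still arrives after the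
start of the round. -/
lemma pulse_sub_start_ge (H : Driven P f h Y) (r : ℕ) :
    (1 + P.μ) * P.E ≤ Y.pulse r - Y.start r := by
  have h1 := H.base_pulse r
  have h2 := H.base_le (H.start_le_pulse r)
  rw [H.adm.τ₁_eq] at h1
  have h3 := mul_left_cancel₀ H.adm.one_add_φ_pos.ne' h1
  rw [h3] at h2
  have h4 : P.θg * ((1 + P.μ) * P.E) ≤ P.θg * (Y.pulse r - Y.start r) := by linarith
  exact le_of_mul_le_mul_left h4 (by linarith [H.adm.one_lt_θg])

lemma pulse_sub_start_le (H : Driven P f h Y) (r : ℕ) :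
    Y.pulse r - Y.start r ≤ (1 + P.μ) * P.θg * P.E := by
  have h1 := H.base_pulse r
  have h2 := H.base_ge (H.start_le_pulse r)
  rw [H.adm.τ₁_eq] at h1
  have h3 := mul_left_cancel₀ H.adm.one_add_φ_pos.ne' h1
  linarith

/-- Phase 2 is this long so that a pulse sent up to `E` after the own one, with delay up to `d`,
still arrives in the listening window. -/
lemma corr_sub_pulse_ge (H : Driven P f h Y) (r : ℕ) :
    P.E + P.d ≤ Y.corr r - Y.pulse r := by
  have h1 := H.base_corr r
  have h2 := H.base_le (H.pulse_le_corr r)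
  rw [H.adm.τ₂_eq] at h1
  have h3 := mul_left_cancel₀ H.adm.one_add_φ_pos.ne' h1
  rw [h3] at h2
  have h4 : P.θg * ((1 + P.μ) * (P.E + P.d)) ≤ P.θg * (Y.corr r - Y.pulse r) := by linarith
  have := le_of_mul_le_mul_left h4 (by linarith [H.adm.one_lt_θg])
  nlinarith [H.adm.μ_pos, H.adm.E_pos, H.adm.d_pos]

lemma start_mono (H : Driven P f h Y) : Monotone Y.start :=
  monotone_nat_of_le_succ fun r => (H.start_le_corr r).trans (H.corr_le_start r)

lemma pulse_add_d_le (H : Driven P f h Y) {r r' : ℕ} (hr : r < r') :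
    Y.pulse r + P.d ≤ Y.pulse r' := by
  have h1 := H.corr_sub_pulse_ge r
  have h2 := H.corr_le_start r
  have h3 := H.start_mono (Nat.succ_le_of_lt hr)
  have h4 := H.start_le_pulse r'
  simp only [Nat.succ_eq_add_one] at h3
  linarith [H.adm.E_pos]

lemma start_nonneg (H : Driven P f h Y) (r : ℕ) : 0 ≤ Y.start r := by
  rw [← H.follows.start_zero]; exact H.start_mono (Nat.zero_le r)

/-- During phases 1 and 2 the logical clock runs at a rate in `(1 + φ) [1, ϑ_g]`. -/
lemma L_sub_early (H : Driven P f h Y) (r : ℕ) {a b : ℝ} (ha : Y.start r ≤ a) (hab : a ≤ b)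
    (hb : b ≤ Y.corr r) :
    (1 + P.φ) * (b - a) ≤ Y.L P h b - Y.L P h a ∧
      Y.L P h b - Y.L P h a ≤ (1 + P.φ) * (P.θg * (b - a)) := by
  have h1 := H.L_sub_start r ha (hab.trans hb)
  have h2 := H.L_sub_start r (ha.trans hab) hb
  have h3 : Y.L P h b - Y.L P h a = (1 + P.φ) * (Y.base P h b - Y.base P h a) := by linarith
  rw [h3]
  exact ⟨mul_le_mul_of_nonneg_left (H.base_ge hab) H.adm.one_add_φ_pos.le,
    mul_le_mul_of_nonneg_left (H.base_le hab) H.adm.one_add_φ_pos.le⟩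

end Driven

end Run

/-! ## Order statistics -/

/-- Otherwise all of `S` would occupy sorted positions below the `k`-th, of which there are only `k
- 1`. -/
lemma orderStat_le {m : ℕ} {x : Fin m → ℝ} {k : ℕ} {b : ℝ} {S : Finset (Fin m)} (hk : 1 ≤ k)
    (hS : k ≤ S.card) (hb : ∀ i ∈ S, x i ≤ b) : orderStat x k ≤ b := by
  have hm : S.card ≤ m := by simpa using S.card_le_univ
  have hi : k - 1 < m := by omega
  unfold orderStat
  rw [dif_pos hi]
  by_contra hlt
  push Not at hlt
  have hsub : S.map (Tuple.sort x).symm.toEmbedding ⊆ Finset.Iio ⟨k - 1, hi⟩ := by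
    intro j hj
    obtain ⟨i, hiS, rfl⟩ := Finset.mem_map.1 hj
    rw [Finset.mem_Iio]
    by_contra hle
    have := Tuple.monotone_sort x (not_lt.1 hle)
    simp only [Function.comp_apply, Equiv.coe_toEmbedding, Equiv.apply_symm_apply] at this
    linarith [hb i hiS]
  have := Finset.card_le_card hsub
  rw [Finset.card_map, Fin.card_Iio] at this
  simp only at this
  omega

lemma le_orderStat {m : ℕ} {x : Fin m → ℝ} {k : ℕ} {b : ℝ} {S : Finset (Fin m)} (hk : 1 ≤ k)
    (hkm : k ≤ m) (hS : m - k + 1 ≤ S.card) (hb : ∀ i ∈ S, b ≤ x i) : b ≤ orderStat x k := by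
  have hi : k - 1 < m := by omega
  unfold orderStat
  rw [dif_pos hi]
  by_contra hlt
  push Not at hlt
  have hsub : S.map (Tuple.sort x).symm.toEmbedding ⊆ Finset.Ioi ⟨k - 1, hi⟩ := by
    intro j hj
    obtain ⟨i, hiS, rfl⟩ := Finset.mem_map.1 hj
    rw [Finset.mem_Ioi]
    by_contra hle
    have := Tuple.monotone_sort x (not_lt.1 hle)
    simp only [Function.comp_apply, Equiv.coe_toEmbedding, Equiv.apply_symm_apply] at this
    linarith [hb i hiS]
  have := Finset.card_le_card hsub
  rw [Finset.card_map, Fin.card_Ioi] at this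
  simp only at this
  omega

/-- Among at least `2 f + 1` values there is one with at least `f + 1` values on either side. -/
lemma exists_middle {ι : Type*} {f : ℕ} (S : Finset ι) (q : ι → ℝ) (hS : 2 * f + 1 ≤ S.card) :
    ∃ i ∈ S, f + 1 ≤ (S.filter fun j => q j ≤ q i).card ∧
      f + 1 ≤ (S.filter fun j => q i ≤ q j).card := by
  classical
  have hne : S.Nonempty := Finset.card_pos.1 (by omega)
  obtain ⟨a, haS, ha⟩ := S.exists_max_image q hne
  have hA : (S.filter fun i => f + 1 ≤ (S.filter fun j => q j ≤ q i).card).Nonempty := by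
    refine ⟨a, Finset.mem_filter.2 ⟨haS, ?_⟩⟩
    rw [Finset.filter_true_of_mem fun j hj => ha j hj]
    omega
  -- Take the lowest member with `f + 1` members at or below it. If more than `f` were strictly
  -- below it, the highest of these would be a lower choice.
  obtain ⟨i, hi, hmin⟩ := Finset.exists_min_image _ q hA
  rw [Finset.mem_filter] at hi
  refine ⟨i, hi.1, hi.2, ?_⟩
  have hsplit := S.card_filter_add_card_filter_not (fun j => q i ≤ q j)
  suffices (S.filter fun j => ¬ q i ≤ q j).card ≤ f by omega
  rcases (S.filter fun j => ¬ q i ≤ q j).eq_empty_or_nonempty with h0 | h0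
  · rw [h0]; simp
  · obtain ⟨b, hb, hbmax⟩ := Finset.exists_max_image _ q h0
    rw [Finset.mem_filter] at hb
    by_contra hlt
    have hlt := not_le.1 hlt
    have hle : (S.filter fun j => ¬ q i ≤ q j).card ≤ (S.filter fun j => q j ≤ q b).card := by
      refine Finset.card_le_card fun j hj => Finset.mem_filter.2 ⟨(Finset.mem_filter.1 hj).1, hbmax j hj⟩
    exact hb.2 (hmin b (Finset.mem_filter.2 ⟨hb.1, by omega⟩))

/-! ## One round of a cluster -/

namespace Run

variable {m : ℕ} {P : Params} {f : ℕ} {good : Finset (Fin m)} {q : Fin m → ℝ} {h : ℝ → ℝ}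
  {Y : Run m} {r : ℕ}

/-- In round `r`, the run `Y` registers the pulses that the good cluster members send at the times
`q i`, and these are close to its own pulse. -/
structure Heard (P : Params) (f : ℕ) (good : Finset (Fin m)) (q : Fin m → ℝ) (h : ℝ → ℝ)
    (Y : Run m) (r : ℕ) : Prop where
  driven : Driven P f h Y
  many : 3 * f + 1 ≤ m
  quorum : m ≤ good.card + f
  close : ∀ i ∈ good, |Y.pulse r - q i| ≤ P.E
  obs_mem : ∀ i ∈ good, Y.obs i r ∈ Icc (q i + P.d - P.U) (q i + P.d)
  self_mem : Y.self r ∈ Icc (Y.pulse r + P.d - P.U) (Y.pulse r + P.d)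

/-- Upper bound for a nominal clock difference over a signed time span of at most `w`. -/
def up (P : Params) (w : ℝ) : ℝ := w + (P.θg - 1) * max w 0

/-- Lower bound for a nominal clock difference over a signed time span of at least `w`. -/
def lo (P : Params) (w : ℝ) : ℝ := w - (P.θg - 1) * max (-w) 0

namespace Heard

lemma self_window (H : Heard P f good q h Y r) : Y.self r ∈ Icc (Y.start r) (Y.corr r) := by
  have h1 := H.self_mem
  have h2 := H.driven.start_le_pulse r
  have h3 := H.driven.corr_sub_pulse_ge r
  have := H.driven.adm.U_lt_d
  have := H.driven.adm.E_pos
  exact ⟨by linarith [h1.1], by linarith [h1.2]⟩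

lemma obs_window (H : Heard P f good q h Y r) {i : Fin m} (hi : i ∈ good) :
    Y.obs i r ∈ Icc (Y.start r) (Y.corr r) := by
  have h1 := H.obs_mem i hi
  have h2 := H.driven.pulse_sub_start_ge r
  have h3 := H.driven.corr_sub_pulse_ge r
  have h4 := abs_le.1 (H.close i hi)
  have := H.driven.adm.U_lt_d
  have := mul_pos H.driven.adm.μ_pos H.driven.adm.E_pos
  exact ⟨by linarith [h1.1], by linarith [h1.2]⟩

/-- A positive span is stretched by at most `θg`, whereas a negative one counts at least at rate
`1`. This is the case distinction hidden in `up`. -/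
lemma offset_le (H : Heard P f good q h Y r) {i : Fin m} (hi : i ∈ good) {w : ℝ}
    (hw : q i - Y.pulse r + P.U ≤ w) :
    Y.L P h (Y.obs i r) - Y.L P h (Y.self r) ≤ (1 + P.φ) * up P w := by
  have h1 := H.obs_mem i hi
  have h2 := H.self_mem
  have hn := H.driven.adm.one_add_φ_pos
  have hθ := H.driven.adm.one_lt_θg
  have hw0 := le_max_left w 0
  have hw1 := le_max_right w 0
  unfold up
  rcases le_total (Y.self r) (Y.obs i r) with hle | hle
  · have h3 := (H.driven.L_sub_early r H.self_window.1 hle (H.obs_window hi).2).2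
    refine h3.trans (mul_le_mul_of_nonneg_left ?_ hn.le)
    have : 0 ≤ w := by linarith [h1.2, h2.1]
    rw [max_eq_left this]
    have : Y.obs i r - Y.self r ≤ w := by linarith [h1.2, h2.1]
    nlinarith
  · have h3 := (H.driven.L_sub_early r (H.obs_window hi).1 hle H.self_window.2).1
    have : (1 + P.φ) * (Y.obs i r - Y.self r) ≤ (1 + P.φ) * (w + (P.θg - 1) * max w 0) := by
      refine mul_le_mul_of_nonneg_left ?_ hn.le
      have := mul_nonneg (by linarith : 0 ≤ P.θg - 1) hw1
      linarith [h1.2, h2.1]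
    linarith

lemma le_offset (H : Heard P f good q h Y r) {i : Fin m} (hi : i ∈ good) {w : ℝ}
    (hw : w ≤ q i - Y.pulse r - P.U) :
    (1 + P.φ) * lo P w ≤ Y.L P h (Y.obs i r) - Y.L P h (Y.self r) := by
  have h1 := H.obs_mem i hi
  have h2 := H.self_mem
  have hn := H.driven.adm.one_add_φ_pos
  have hθ := H.driven.adm.one_lt_θg
  have hw1 := le_max_right (-w) 0
  unfold lo
  rcases le_total (Y.obs i r) (Y.self r) with hle | hle
  · have h3 := (H.driven.L_sub_early r (H.obs_window hi).1 hle H.self_window.2).2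
    have : (1 + P.φ) * (P.θg * (Y.self r - Y.obs i r)) ≤
        (1 + P.φ) * (-(w - (P.θg - 1) * max (-w) 0)) := by
      refine mul_le_mul_of_nonneg_left ?_ hn.le
      have : 0 ≤ -w := by linarith [h1.1, h2.2]
      rw [max_eq_left this]
      have : Y.self r - Y.obs i r ≤ -w := by linarith [h1.1, h2.2]
      nlinarith
    linarith
  · have h3 := (H.driven.L_sub_early r H.self_window.1 hle (H.obs_window hi).2).1
    refine le_trans (mul_le_mul_of_nonneg_left ?_ hn.le) h3
    have := mul_nonneg (by linarith : 0 ≤ P.θg - 1) hw1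
    linarith [h1.1, h2.2]

/-- The lower order statistic is controlled by any `f + 1` good members, the upper one by all of
them, as there are at least `m - f`. Faulty entries cannot push either beyond these bounds. -/
lemma Δ_le (H : Heard P f good q h Y r) {S : Finset (Fin m)} (hS : S ⊆ good)
    (hcard : f + 1 ≤ S.card) {w₁ w₂ : ℝ} (h₁ : ∀ i ∈ S, q i - Y.pulse r + P.U ≤ w₁)
    (h₂ : ∀ i ∈ good, q i - Y.pulse r + P.U ≤ w₂) :
    Y.Δ P f h r ≤ (1 + P.φ) * ((up P w₁ + up P w₂) / 2) := by
  have hm := H.many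
  have hq := H.quorum
  have a1 := orderStat_le (x := fun i => Y.L P h (Y.obs i r) - Y.L P h (Y.self r)) (k := f + 1)
    (by omega) hcard fun i hi => H.offset_le (hS hi) (h₁ i hi)
  have a2 := orderStat_le (x := fun i => Y.L P h (Y.obs i r) - Y.L P h (Y.self r)) (k := m - f)
    (S := good) (by omega) (by omega) fun i hi => H.offset_le hi (h₂ i hi)
  unfold Run.Δ
  linarith

lemma le_Δ (H : Heard P f good q h Y r) {S : Finset (Fin m)} (hS : S ⊆ good)
    (hcard : f + 1 ≤ S.card) {w₁ w₂ : ℝ} (h₁ : ∀ i ∈ S, w₁ ≤ q i - Y.pulse r - P.U)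
    (h₂ : ∀ i ∈ good, w₂ ≤ q i - Y.pulse r - P.U) :
    (1 + P.φ) * ((lo P w₁ + lo P w₂) / 2) ≤ Y.Δ P f h r := by
  have hm := H.many
  have hq := H.quorum
  have a1 := le_orderStat (x := fun i => Y.L P h (Y.obs i r) - Y.L P h (Y.self r)) (k := m - f)
    (S := S) (by omega) (by omega) (by omega) fun i hi => H.le_offset (hS hi) (h₁ i hi)
  have a2 := le_orderStat (x := fun i => Y.L P h (Y.obs i r) - Y.L P h (Y.self r)) (k := f + 1)
    (S := good) (by omega) (by omega) (by omega) fun i hi => H.le_offset hi (h₂ i hi)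
  unfold Run.Δ
  linarith

lemma quorum' (H : Heard P f good q h Y r) : 2 * f + 1 ≤ good.card := by
  have hm := H.many
  have hq := H.quorum
  omega

lemma abs_Δ_le (H : Heard P f good q h Y r) :
    |Y.Δ P f h r| ≤ (1 + P.φ) * (P.θg * (P.E + P.U)) := by
  have hq := H.quorum'
  have hE : 0 ≤ P.E + P.U := by linarith [H.driven.adm.E_pos, H.driven.adm.U_nonneg]
  have h1 := H.Δ_le (w₁ := P.E + P.U) (w₂ := P.E + P.U) (le_refl good) (by omega)
    (fun i hi => by linarith [abs_le.1 (H.close i hi)])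
    (fun i hi => by linarith [abs_le.1 (H.close i hi)])
  have h2 := H.le_Δ (w₁ := -(P.E + P.U)) (w₂ := -(P.E + P.U)) (le_refl good) (by omega)
    (fun i hi => by linarith [abs_le.1 (H.close i hi)])
    (fun i hi => by linarith [abs_le.1 (H.close i hi)])
  unfold up at h1
  unfold lo at h2
  rw [neg_neg] at h2
  rw [max_eq_left hE] at h1 h2
  rw [abs_le]
  constructor <;> linarith

/-- The length of phase 3 is chosen for this: `φ τ₃` covers the largest possible correction, so
amortizing it changes the rate by `O(φ)` only. -/
lemma abs_Δ_le_φ (H : Heard P f good q h Y r) : |Y.Δ P f h r| ≤ P.φ * P.τ₃ := by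
  refine H.abs_Δ_le.trans ?_
  rw [H.driven.adm.φ_mul_τ₃]
  have hE : 0 ≤ P.θg * (P.E + P.U) := mul_nonneg (by linarith [H.driven.adm.one_lt_θg])
    (by linarith [H.driven.adm.E_pos, H.driven.adm.U_nonneg])
  refine mul_le_mul_of_nonneg_left ?_ H.driven.adm.one_add_φ_pos.le
  nlinarith [H.driven.adm.μ_pos]

lemma Δ_late_pos (H : Heard P f good q h Y r) : 0 < P.τ₃ + Y.Δ P f h r := by
  have h1 := abs_le.1 H.abs_Δ_le_φ
  have h2 : P.φ < 1 / 2 := by linarith [H.driven.adm.φ_le, H.driven.adm.ε_le]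
  nlinarith [H.driven.adm.τ₃_pos]

lemma pulse_le_succ (H : Heard P f good q h Y r) : Y.pulse r ≤ Y.pulse (r + 1) := by
  linarith [H.driven.pulse_add_d_le (Nat.lt_succ_self r), H.driven.adm.d_pos]

/-- The nominal round length, without the correction, in units of the nominal rate. -/
lemma base_pulse_succ (H : Heard P f good q h Y r) :
    Y.base P h (Y.pulse (r + 1)) - Y.base P h (Y.pulse r) =
      (P.T + Y.Δ P f h r) / (1 + P.φ) := by
  rw [eq_div_iff H.driven.adm.one_add_φ_pos.ne', mul_comm]
  exact H.driven.base_pulse_succ r H.Δ_late_pos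

lemma pulse_succ_le (H : Heard P f good q h Y r) {S : Finset (Fin m)} (hS : S ⊆ good)
    (hcard : f + 1 ≤ S.card) {w₁ w₂ : ℝ} (h₁ : ∀ i ∈ S, q i - Y.pulse r + P.U ≤ w₁)
    (h₂ : ∀ i ∈ good, q i - Y.pulse r + P.U ≤ w₂) :
    Y.base P h (Y.pulse (r + 1)) - Y.base P h (Y.pulse r) ≤
      P.T / (1 + P.φ) + (up P w₁ + up P w₂) / 2 := by
  rw [H.base_pulse_succ, add_div P.T]
  have := H.Δ_le hS hcard h₁ h₂
  rw [← div_le_iff₀' H.driven.adm.one_add_φ_pos] at this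
  linarith

lemma le_pulse_succ (H : Heard P f good q h Y r) {S : Finset (Fin m)} (hS : S ⊆ good)
    (hcard : f + 1 ≤ S.card) {w₁ w₂ : ℝ} (h₁ : ∀ i ∈ S, w₁ ≤ q i - Y.pulse r - P.U)
    (h₂ : ∀ i ∈ good, w₂ ≤ q i - Y.pulse r - P.U) :
    P.T / (1 + P.φ) + (lo P w₁ + lo P w₂) / 2 ≤
      Y.base P h (Y.pulse (r + 1)) - Y.base P h (Y.pulse r) := by
  rw [H.base_pulse_succ, add_div P.T]
  have := H.le_Δ hS hcard h₁ h₂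
  rw [← le_div_iff₀' H.driven.adm.one_add_φ_pos] at this
  linarith

lemma up_le (hP : P.Admissible) {w : ℝ} (hw : w ≤ P.E + P.U) :
    up P w ≤ w + (P.θg - 1) * (P.E + P.U) := by
  have : max w 0 ≤ P.E + P.U := max_le hw (by linarith [hP.E_pos, hP.U_nonneg])
  have := mul_le_mul_of_nonneg_left this (by linarith [hP.one_lt_θg] : 0 ≤ P.θg - 1)
  unfold up; linarith

lemma lo_ge (hP : P.Admissible) {w : ℝ} (hw : -(P.E + P.U) ≤ w) :
    w - (P.θg - 1) * (P.E + P.U) ≤ lo P w := by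
  have : max (-w) 0 ≤ P.E + P.U := max_le (by linarith) (by linarith [hP.E_pos, hP.U_nonneg])
  have := mul_le_mul_of_nonneg_left this (by linarith [hP.one_lt_θg] : 0 ≤ P.θg - 1)
  unfold lo; linarith

/-- A bound with `θg` as the factor of `w`, so that it survives division by the maximal rate `θg` in
`pulse_succ_sub_le`. -/
lemma lo_ge_mul (hP : P.Admissible) {w : ℝ} (hw : w ≤ P.E) :
    P.θg * w - (P.θg - 1) * P.E ≤ lo P w := by
  have hθ := hP.one_lt_θg
  unfold lo
  rcases le_total 0 w with h0 | h0
  · rw [max_eq_right (by linarith)]; nlinarith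
  · rw [max_eq_left (by linarith)]; nlinarith [hP.E_pos]

/-- The pulse diameter bound `E` is preserved from one round to the next. -/
lemma pulse_succ_sub_le {h' : ℝ → ℝ} {Z : Run m} (H : Heard P f good q h Y r)
    (H' : Heard P f good q h' Z r) (hq : ∀ i ∈ good, ∀ j ∈ good, q i - q j ≤ P.E) :
    Y.pulse (r + 1) - Z.pulse (r + 1) ≤ P.E := by
  have hP := H.driven.adm
  have hθ := hP.one_lt_θg
  have hn := hP.one_add_φ_pos
  have hE := hP.E_pos
  have hU := hP.U_nonneg
  -- The middle pulse `c` bounds one order statistic of `Y` from above and one of `Z` from below. It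
  -- cancels in the difference, and half the spread of the outer pulses `b` and `a` remains.
  obtain ⟨c, hc, hcl, hcr⟩ := exists_middle good q H.quorum'
  have hne : good.Nonempty := ⟨c, hc⟩
  obtain ⟨a, ha, hamin⟩ := good.exists_min_image q hne
  obtain ⟨b, hb, hbmax⟩ := good.exists_max_image q hne
  have yc := abs_le.1 (H.close c hc)
  have yb := abs_le.1 (H.close b hb)
  have za := abs_le.1 (H'.close a ha)
  have zc := abs_le.1 (H'.close c hc)
  have hba := hq b hb a ha
  set X := 2 * P.E + P.d + P.c₁ * (P.E + P.U) with hX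
  have hT : P.T / (1 + P.φ) = (1 + P.μ) * P.θg * X := by
    rw [hP.T_eq, ← hX]; field_simp
  have u1 := H.pulse_succ_le (w₁ := q c - Y.pulse r + P.U) (w₂ := q b - Y.pulse r + P.U)
    (Finset.filter_subset _ _) hcl
    (fun i hi => by linarith [(Finset.mem_filter.1 hi).2]) (fun i hi => by linarith [hbmax i hi])
  have u2 := up_le hP (w := q c - Y.pulse r + P.U) (by linarith)
  have u3 := up_le hP (w := q b - Y.pulse r + P.U) (by linarith)
  have u4 := H.driven.base_ge H.pulse_le_succ
  have l1 := H'.le_pulse_succ (w₁ := q c - Z.pulse r - P.U) (w₂ := q a - Z.pulse r - P.U)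
    (Finset.filter_subset _ _) hcr
    (fun i hi => by linarith [(Finset.mem_filter.1 hi).2]) (fun i hi => by linarith [hamin i hi])
  have l2 := lo_ge_mul hP (w := q c - Z.pulse r - P.U) (by linarith)
  have l3 := lo_ge_mul hP (w := q a - Z.pulse r - P.U) (by linarith)
  have l4 := H'.driven.base_le H'.pulse_le_succ
  have l5 : P.θg * ((1 + P.μ) * X + (q c + q a) / 2 - Z.pulse r - P.U - (1 - 1 / P.θg) * P.E) ≤
      P.θg * (Z.pulse (r + 1) - Z.pulse r) := by
    have : P.θg * ((1 - 1 / P.θg) * P.E) = (P.θg - 1) * P.E := by field_simp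
    rw [hT] at l1
    linarith
  have l6 := le_of_mul_le_mul_left l5 (by linarith)
  rw [hT] at u1
  -- There remain half the spread, the stretch `γg X` of the round, `2 U` and the drift terms of
  -- `up` and `lo`. By `E_fixed` and `contr_ge` they sum to at most `E`.
  have k1 := hP.E_fixed
  have k2 := mul_le_mul_of_nonneg_right hP.contr_ge hE.le
  have k3 : P.γg * X = (1 + P.μ) * P.θg * X - (1 + P.μ) * X := by rw [hP.γg_eq]; ring
  have k4 : (P.θg - 1) * (1 + 1 / P.θg) * P.E = (P.θg - 1) * P.E + (1 - 1 / P.θg) * P.E := by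
    field_simp
  have k5 : P.γg * X = 2 * P.γg * P.E + P.γg * P.d + P.γg * P.c₁ * P.E + P.γg * P.c₁ * P.U := by
    rw [hX]; ring
  have k6 := mul_nonneg (by linarith : 0 ≤ P.θg - 1) hU
  linarith

end Heard

end Run

/-! ### Induction over rounds: a cluster and its listeners stay within `E` -/

namespace Run

variable {m : ℕ} {P : Params} {f : ℕ} {good : Finset (Fin m)} {p : Fin m → ℕ → ℝ} {h : ℝ → ℝ}
  {Y : Run m} {arr : Fin m → ℕ → ℝ}

/-- The run `Y` listens to the pulses `p i` of the good members of a cluster, which arrive at the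
times `arr i`; its own pulse is delivered within the delay bounds or is that of a good member. -/
structure Listener (P : Params) (f : ℕ) (good : Finset (Fin m)) (p : Fin m → ℕ → ℝ) (h : ℝ → ℝ)
    (Y : Run m) (arr : Fin m → ℕ → ℝ) : Prop where
  driven : Driven P f h Y
  many : 3 * f + 1 ≤ m
  quorum : m ≤ good.card + f
  spaced : ∀ i ∈ good, ∀ r r', r < r' → p i r + P.d ≤ p i r'
  arr_mem : ∀ i ∈ good, ∀ r, arr i r ∈ Icc (p i r + P.d - P.U) (p i r + P.d)
  records : ∀ i ∈ good, ∀ r, Records (arr i) (Y.start r) (Y.corr r) (Y.obs i r)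
  self_mem : ∀ r, Y.self r ∈ Icc (Y.pulse r + P.d - P.U) (Y.pulse r + P.d) ∨
    ∃ i ∈ good, Y.self r = Y.obs i r ∧ Y.pulse r = p i r

namespace Listener

lemma arr_window (H : Listener P f good p h Y arr) {r : ℕ} {i : Fin m} (hi : i ∈ good)
    (hc : |Y.pulse r - p i r| ≤ P.E) : arr i r ∈ Icc (Y.start r) (Y.corr r) := by
  have h1 := H.arr_mem i hi r
  have h2 := H.driven.pulse_sub_start_ge r
  have h3 := H.driven.corr_sub_pulse_ge r
  have h4 := abs_le.1 hc
  have := H.driven.adm.U_lt_d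
  have := mul_pos H.driven.adm.μ_pos H.driven.adm.E_pos
  exact ⟨by linarith [h1.1], by linarith [h1.2]⟩

/-- Pulses of earlier rounds arrive inside earlier windows, hence before this one, and later pulses
are sent at least `d` later. So the first reception in the window belongs to round `r`. -/
lemma obs_eq (H : Listener P f good p h Y arr) {r : ℕ} {i : Fin m} (hi : i ∈ good)
    (hc : ∀ r' ≤ r, |Y.pulse r' - p i r'| ≤ P.E) : Y.obs i r = arr i r := by
  have hw := H.arr_window hi (hc r le_rfl)
  refine (H.records i hi r ⟨r, hw⟩).unique ⟨⟨hw, r, rfl⟩, ?_⟩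
  rintro t ⟨ht, r', rfl⟩
  rcases lt_trichotomy r' r with hr | rfl | hr
  · have h1 := (H.arr_window hi (hc r' hr.le)).2
    have h2 := H.driven.corr_lt_start r'
    have h3 := H.driven.start_mono (Nat.succ_le_of_lt hr)
    simp only [Nat.succ_eq_add_one] at h3
    linarith [ht.1]
  · exact le_rfl
  · have h1 := (H.arr_mem i hi r').1
    have h2 := (H.arr_mem i hi r).2
    linarith [H.spaced i hi r r' hr, H.driven.adm.U_lt_d]

lemma heard (H : Listener P f good p h Y arr) {r : ℕ}
    (hc : ∀ r' ≤ r, ∀ i ∈ good, |Y.pulse r' - p i r'| ≤ P.E) :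
    Heard P f good (fun i => p i r) h Y r where
  driven := H.driven
  many := H.many
  quorum := H.quorum
  close := hc r le_rfl
  obs_mem i hi := by
    rw [H.obs_eq hi fun r' hr' => hc r' hr' i hi]
    exact H.arr_mem i hi r
  self_mem := by
    rcases H.self_mem r with h1 | ⟨i, hi, h1, h2⟩
    · exact h1
    · rw [h1, h2, H.obs_eq hi fun r' hr' => hc r' hr' i hi]
      exact H.arr_mem i hi r

end Listener

/-- All runs start at time `0`, so the first pulses differ only by the drift over phase 1, at most
`γg E`. -/
lemma Driven.pulse_zero_sub_le {h' : ℝ → ℝ} {Z : Run m} (H : Driven P f h Y)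
    (H' : Driven P f h' Z) : Y.pulse 0 - Z.pulse 0 ≤ P.E := by
  have h1 := H.pulse_sub_start_le 0
  have h2 := H'.pulse_sub_start_ge 0
  rw [H.follows.start_zero] at h1
  rw [H'.follows.start_zero] at h2
  have h3 : P.γg * P.E ≤ 1 * P.E :=
    mul_le_mul_of_nonneg_right (by linarith [H.adm.γg_le, H.adm.ε_le]) H.adm.E_pos.le
  rw [H.adm.γg_eq] at h3
  linarith

/-- The good members of a cluster, all of which listen to each other. -/
def IsCluster (P : Params) (f : ℕ) (good : Finset (Fin m)) (hw : Fin m → ℝ → ℝ)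
    (run : Fin m → Run m) (arr : Fin m → Fin m → ℕ → ℝ) : Prop :=
  ∀ i ∈ good, Listener P f good (fun j => (run j).pulse) (hw i) (run i) fun j => arr j i

variable {hw : Fin m → ℝ → ℝ} {run : Fin m → Run m} {arrs : Fin m → Fin m → ℕ → ℝ}

/-- The induction is strong because identifying the pulse heard in a round uses closeness in all
earlier rounds. -/
lemma IsCluster.close (H : IsCluster P f good hw run arrs) (r : ℕ) :
    ∀ i ∈ good, ∀ j ∈ good, |(run i).pulse r - (run j).pulse r| ≤ P.E := by
  induction r using Nat.strong_induction_on with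
  | _ r ih =>
    suffices ∀ i ∈ good, ∀ j ∈ good, (run i).pulse r - (run j).pulse r ≤ P.E from
      fun i hi j hj => abs_sub_le_iff.2 ⟨this i hi j hj, this j hj i hi⟩
    intro i hi j hj
    cases r with
    | zero => exact (H i hi).driven.pulse_zero_sub_le (H j hj).driven
    | succ r =>
      refine ((H i hi).heard fun r' hr' => ih r' (Nat.lt_succ_of_le hr') i hi).pulse_succ_sub_le
        ((H j hj).heard fun r' hr' => ih r' (Nat.lt_succ_of_le hr') j hj) fun a ha b hb => ?_
      exact (abs_le.1 (ih r (Nat.lt_succ_self r) a ha b hb)).2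

/-- Every listener stays within `E` of the cluster it listens to. -/
lemma IsCluster.close_listener (H : IsCluster P f good hw run arrs)
    (HY : Listener P f good (fun j => (run j).pulse) h Y arr) (r : ℕ) :
    ∀ i ∈ good, |Y.pulse r - (run i).pulse r| ≤ P.E := by
  induction r using Nat.strong_induction_on with
  | _ r ih =>
    intro i hi
    cases r with
    | zero =>
      exact abs_sub_le_iff.2 ⟨HY.driven.pulse_zero_sub_le (H i hi).driven,
        (H i hi).driven.pulse_zero_sub_le HY.driven⟩
    | succ r =>
      have h1 := HY.heard fun r' hr' => ih r' (Nat.lt_succ_of_le hr')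
      have h2 := (H i hi).heard (r := r) fun r' _ => H.close r' i hi
      have h3 : ∀ a ∈ good, ∀ b ∈ good, (run a).pulse r - (run b).pulse r ≤ P.E :=
        fun a ha b hb => (abs_le.1 (H.close r a ha b hb)).2
      exact abs_sub_le_iff.2 ⟨h1.pulse_succ_sub_le h2 h3, h2.pulse_succ_sub_le h1 h3⟩

lemma IsCluster.heard (H : IsCluster P f good hw run arrs)
    (HY : Listener P f good (fun j => (run j).pulse) h Y arr) (r : ℕ) :
    Heard P f good (fun j => (run j).pulse r) h Y r :=
  HY.heard fun r' _ => H.close_listener HY r'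

/-! ## Runs with small corrections -/

/-- A run all of whose corrections are so small that its logical clock always runs at a rate
close to `1`. -/
structure Steady (P : Params) (f : ℕ) (h : ℝ → ℝ) (Y : Run m) : Prop where
  driven : Driven P f h Y
  abs_Δ_le : ∀ r, |Y.Δ P f h r| ≤ P.φ * P.τ₃

lemma IsCluster.steady (H : IsCluster P f good hw run arrs)
    (HY : Listener P f good (fun j => (run j).pulse) h Y arr) : Steady P f h Y :=
  ⟨HY.driven, fun r => (H.heard HY r).abs_Δ_le_φ⟩

namespace Steady

lemma late_bounds (H : Steady P f h Y) (r : ℕ) :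
    1 ≤ 1 + P.φ * Driven.late P f h Y r ∧
      (1 + P.φ * Driven.late P f h Y r) * P.θg ≤ 1 + 6 * P.ε := by
  have hP := H.driven.adm
  have h1 := abs_le.1 (H.abs_Δ_le r)
  have hφ := hP.φ_pos
  have hφ2 : P.φ < 1 / 2 := by linarith [hP.φ_le, hP.ε_le]
  have hτ := hP.τ₃_pos
  have hθ := hP.one_lt_θg
  have hpos : 0 < P.τ₃ + Y.Δ P f h r := by nlinarith
  have h2 : 1 + P.φ * Driven.late P f h Y r = (1 + P.φ) * P.τ₃ / (P.τ₃ + Y.Δ P f h r) := by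
    unfold Driven.late; field_simp; ring
  rw [h2]
  constructor
  · rw [le_div_iff₀ hpos]; linarith
  · rw [div_mul_eq_mul_div, div_le_iff₀ hpos]
    have h3 := mul_le_mul_of_nonneg_right hP.rate_le hτ.le
    have h4 : (1 + 6 * P.ε) * ((1 - P.φ) * P.τ₃) ≤ (1 + 6 * P.ε) * (P.τ₃ + Y.Δ P f h r) :=
      mul_le_mul_of_nonneg_left (by linarith) (by linarith [hP.ε_pos])
    linarith

lemma L_sub_round (H : Steady P f h Y) (r : ℕ) {a b : ℝ} (ha : Y.start r ≤ a) (hab : a ≤ b)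
    (hb : b ≤ Y.start (r + 1)) :
    b - a ≤ Y.L P h b - Y.L P h a ∧ Y.L P h b - Y.L P h a ≤ (1 + 6 * P.ε) * (b - a) := by
  have hP := H.driven.adm
  have early : ∀ a b, Y.start r ≤ a → a ≤ b → b ≤ Y.corr r →
      b - a ≤ Y.L P h b - Y.L P h a ∧ Y.L P h b - Y.L P h a ≤ (1 + 6 * P.ε) * (b - a) := by
    intro a b ha hab hb
    have h1 := H.driven.L_sub_early r ha hab hb
    have h2 := mul_le_mul_of_nonneg_right hP.nominal_le (sub_nonneg.2 hab)
    exact ⟨by nlinarith [hP.φ_pos], by linarith⟩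
  have late : ∀ a b, Y.corr r ≤ a → a ≤ b → b ≤ Y.start (r + 1) →
      b - a ≤ Y.L P h b - Y.L P h a ∧ Y.L P h b - Y.L P h a ≤ (1 + 6 * P.ε) * (b - a) := by
    intro a b ha hab hb
    have h1 := H.driven.L_sub_corr r ha (hab.trans hb)
    have h2 := H.driven.L_sub_corr r (ha.trans hab) hb
    have h3 := H.late_bounds r
    have h4 := H.driven.base_ge hab
    have h5 := H.driven.base_le hab
    have h6 := mul_le_mul_of_nonneg_left h5 (zero_le_one.trans h3.1)
    have h7 := mul_le_mul_of_nonneg_right h3.2 (sub_nonneg.2 hab)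
    have h8 := mul_le_mul h3.1 h4 (sub_nonneg.2 hab) (zero_le_one.trans h3.1)
    exact ⟨by linarith, by linarith⟩
  rcases le_total b (Y.corr r) with h1 | h1
  · exact early a b ha hab h1
  · rcases le_total a (Y.corr r) with h2 | h2
    · have := early a _ ha h2 le_rfl
      have := late _ b le_rfl h1 hb
      constructor <;> linarith
    · exact late a b h2 hab hb

lemma L_sub_start (H : Steady P f h Y) (r : ℕ) : ∀ {a b : ℝ}, 0 ≤ a → a ≤ b → b ≤ Y.start r →
    b - a ≤ Y.L P h b - Y.L P h a ∧ Y.L P h b - Y.L P h a ≤ (1 + 6 * P.ε) * (b - a) := by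
  induction r with
  | zero =>
    intro a b ha hab hb
    rw [H.driven.follows.start_zero] at hb
    rw [show a = 0 by linarith, show b = 0 by linarith]; simp
  | succ r ih =>
    intro a b ha hab hb
    rcases le_total b (Y.start r) with h1 | h1
    · exact ih ha hab h1
    · rcases le_total a (Y.start r) with h2 | h2
      · have := ih ha h2 le_rfl
        have := H.L_sub_round r le_rfl h1 hb
        constructor <;> linarith
      · exact H.L_sub_round r h2 hab hb

/-- Rounds cannot accumulate: the clock reads `r T` at the start of round `r` and its rate is
bounded. -/
lemma exists_le_start (H : Steady P f h Y) (t : ℝ) : ∃ r, t ≤ Y.start r := by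
  have hP := H.driven.adm
  obtain ⟨r, hr⟩ := Archimedean.arch ((1 + 6 * P.ε) * |t|) hP.T_pos
  refine ⟨r, ?_⟩
  have h1 := (H.L_sub_start r le_rfl (H.driven.start_nonneg r) le_rfl).2
  rw [Driven.L_zero, H.driven.L_start] at h1
  rw [nsmul_eq_mul] at hr
  have h2 : (1 + 6 * P.ε) * |t| ≤ (1 + 6 * P.ε) * Y.start r := by linarith
  exact (le_abs_self t).trans (le_of_mul_le_mul_left h2 (by linarith [hP.ε_pos]))

lemma L_sub (H : Steady P f h Y) {a b : ℝ} (ha : 0 ≤ a) (hab : a ≤ b) :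
    b - a ≤ Y.L P h b - Y.L P h a ∧ Y.L P h b - Y.L P h a ≤ (1 + 6 * P.ε) * (b - a) := by
  obtain ⟨r, hr⟩ := H.exists_le_start b
  exact H.L_sub_start r ha hab hr

lemma L_continuousOn (H : Steady P f h Y) : ContinuousOn (Y.L P h) (Ici 0) := by
  have hε := H.driven.adm.ε_pos
  have : LipschitzOnWith (Real.toNNReal (1 + 6 * P.ε)) (Y.L P h) (Ici 0) := by
    refine LipschitzOnWith.of_dist_le_mul fun x hx y hy => ?_
    rw [Real.coe_toNNReal _ (by linarith), Real.dist_eq, Real.dist_eq]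
    rcases le_total x y with hxy | hxy
    · have := H.L_sub hx hxy
      rw [abs_sub_comm, abs_of_nonneg (by linarith), abs_sub_comm, abs_of_nonneg (by linarith)]
      exact this.2
    · have := H.L_sub hy hxy
      rw [abs_of_nonneg (by linarith), abs_of_nonneg (by linarith)]
      exact this.2
  exact this.continuousOn

lemma exists_round (H : Steady P f h Y) {t : ℝ} (ht : 0 ≤ t) :
    ∃ r, Y.start r ≤ t ∧ t < Y.start (r + 1) := by
  classical
  obtain ⟨r₀, hr₀⟩ := H.exists_le_start (t + 1)
  have hex : ∃ r, t < Y.start r := ⟨r₀, by linarith⟩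
  have h1 := Nat.find_spec hex
  have h2 : Nat.find hex ≠ 0 := by
    intro h0; rw [h0, H.driven.follows.start_zero] at h1; linarith
  obtain ⟨r, hr⟩ := Nat.exists_eq_succ_of_ne_zero h2
  refine ⟨r, ?_, by rw [hr] at h1; exact h1⟩
  exact not_lt.1 (Nat.find_min hex (by omega))

lemma start_succ_sub_le (H : Steady P f h Y) (r : ℕ) : Y.start (r + 1) - Y.start r ≤ P.T := by
  have h1 := (H.L_sub (H.driven.start_nonneg r)
    (H.driven.start_mono (Nat.le_succ r))).1
  rw [Nat.succ_eq_add_one, H.driven.L_succ_sub] at h1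
  linarith

/-- Two runs with similar pulse times have similar clocks. -/
lemma L_close {h' : ℝ → ℝ} {Z : Run m} (H : Steady P f h Y) (H' : Steady P f h' Z)
    (hYZ : ∀ r, |Y.pulse r - Z.pulse r| ≤ P.E) {t : ℝ} (ht : 0 ≤ t) :
    |Y.L P h t - Z.L P h' t| ≤ 10 * P.E := by
  have hP := H.driven.adm
  have hεT := hP.ε_mul_T_le
  have hε := hP.ε_pos
  have hE := hP.E_pos
  norm_num at hεT
  obtain ⟨r, hr, hr'⟩ := H.exists_round ht
  cases r with
  | zero =>
    have h1 := H.L_sub le_rfl ht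
    have h2 := H'.L_sub le_rfl ht
    have h3 := H.start_succ_sub_le 0
    rw [Driven.L_zero] at h1 h2
    rw [H.driven.follows.start_zero] at h3
    simp only [zero_add] at hr' h3
    have h4 : P.ε * t ≤ P.ε * P.T := mul_le_mul_of_nonneg_left (by linarith) hε.le
    rw [abs_le]
    constructor <;> linarith
  -- Both clocks read `r T + τ₁` at their own pulse `r`. These pulses are `E` apart and at most `2
  -- T` old, and rates in `[1, 1 + 6 ε]` add at most `12 · 0.6 E`.
  | succ r =>
    have p1 := H.driven.start_le_pulse r
    have p2 := (H.driven.pulse_le_corr r).trans (H.driven.corr_le_start r)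
    have p0 := (H.driven.start_nonneg r).trans p1
    have p0' := (H'.driven.start_nonneg r).trans (H'.driven.start_le_pulse r)
    have h1 := H.L_sub p0 (p2.trans hr)
    have h2 := H'.L_sub p0 (p2.trans hr)
    have h3 := H.start_succ_sub_le r
    have h3' := H.start_succ_sub_le (r + 1)
    have h4 : P.ε * (t - Y.pulse r) ≤ P.ε * (2 * P.T) :=
      mul_le_mul_of_nonneg_left (by linarith) hε.le
    have h5 := abs_le.1 (hYZ r)
    have h6 := H.driven.L_pulse r
    have h7 := H'.driven.L_pulse r
    have hεE : P.ε * P.E ≤ P.E / 1000000 := by nlinarith [hP.ε_le]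
    rw [abs_le]
    rcases le_total (Y.pulse r) (Z.pulse r) with h8 | h8
    · have h9 := H'.L_sub p0 h8
      have h10 : P.ε * (Z.pulse r - Y.pulse r) ≤ P.ε * P.E :=
        mul_le_mul_of_nonneg_left (by linarith) hε.le
      constructor <;> linarith
    · have h9 := H'.L_sub p0' h8
      have h10 : P.ε * (Y.pulse r - Z.pulse r) ≤ P.ε * P.E :=
        mul_le_mul_of_nonneg_left (by linarith) hε.le
      constructor <;> linarith

end Steady

lemma IsCluster.L_close (H : IsCluster P f good hw run arrs)
    (HY : Listener P f good (fun j => (run j).pulse) h Y arr) {i : Fin m} (hi : i ∈ good)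
    {t : ℝ} (ht : 0 ≤ t) : |Y.L P h t - (run i).L P (hw i) t| ≤ 10 * P.E :=
  (H.steady HY).L_close (H.steady (H i hi)) (fun r => H.close_listener HY r i hi) ht

/-! ## Clusters in uniform mode -/

/-- The corrected round begins, up to `e₁`, no earlier than the earliest good pulse dictates, and
`period_le_slow` absorbs this `e₁`. -/
lemma Heard.le_pulse_succ_of_slow {q : Fin m → ℝ} {r : ℕ} (H : Heard P f good q h Y r) {b : ℝ}
    (hb : ∀ i ∈ good, b ≤ q i) (hbY : b ≤ Y.pulse r)
    (hs : ∀ t ∈ Ico (Y.pulse r) (Y.pulse (r + 1)), Y.mode t = 0) :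
    b + P.period ≤ Y.pulse (r + 1) := by
  have hP := H.driven.adm
  -- Good pulses are also at least `Y.pulse r - E`; taking the maximum keeps `w` in the range where
  -- `lo_ge` applies.
  set w := max b (Y.pulse r - P.E) - Y.pulse r - P.U with hw
  have h1 := le_max_left b (Y.pulse r - P.E)
  have h2 := le_max_right b (Y.pulse r - P.E)
  have hle : ∀ i ∈ good, w ≤ q i - Y.pulse r - P.U := by
    intro i hi
    have : max b (Y.pulse r - P.E) ≤ q i :=
      max_le (hb i hi) (by linarith [abs_le.1 (H.close i hi)])
    linarith
  have h3 := H.le_pulse_succ (le_refl good) (by have := H.quorum'; omega) hle hle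
  have h4 := lo_ge hP (w := w) (by linarith)
  have h5 := H.driven.base_le_slow H.pulse_le_succ hs
  have h6 := hP.period_le_slow
  have hρ := hP.ρ_pos
  have he : w - (P.θg - 1) * (P.E + P.U) ≥ b - Y.pulse r - P.e₁ := by
    unfold Params.e₁; linarith
  rw [← div_div] at h6
  have h7 : P.T / (1 + P.φ) + (b - Y.pulse r - P.e₁) ≤
      (1 + P.ρ) * (Y.pulse (r + 1) - Y.pulse r) := by linarith
  have h8 : P.T / (1 + P.φ) / (1 + P.ρ) + (b - Y.pulse r - P.e₁) ≤
      Y.pulse (r + 1) - Y.pulse r := by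
    refine le_of_mul_le_mul_left (le_trans ?_ h7) (by linarith : 0 < 1 + P.ρ)
    rw [mul_add, mul_div_cancel₀ _ (by linarith)]
    have := hP.e₁_nonneg
    nlinarith
  linarith

lemma Heard.pulse_succ_le_of_fast {q : Fin m → ℝ} {r : ℕ} (H : Heard P f good q h Y r) {b : ℝ}
    (hb : ∀ i ∈ good, q i ≤ b) (hbY : Y.pulse r ≤ b)
    (hs : ∀ t ∈ Ico (Y.pulse r) (Y.pulse (r + 1)), Y.mode t = 1) :
    Y.pulse (r + 1) ≤ b + P.period := by
  have hP := H.driven.adm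
  set w := min b (Y.pulse r + P.E) - Y.pulse r + P.U with hw
  have h1 := min_le_left b (Y.pulse r + P.E)
  have h2 := min_le_right b (Y.pulse r + P.E)
  have hle : ∀ i ∈ good, q i - Y.pulse r + P.U ≤ w := by
    intro i hi
    have : q i ≤ min b (Y.pulse r + P.E) :=
      le_min (hb i hi) (by linarith [abs_le.1 (H.close i hi)])
    linarith
  have h3 := H.pulse_succ_le (le_refl good) (by have := H.quorum'; omega) hle hle
  have h4 := up_le hP (w := w) (by linarith)
  have h5 := H.driven.base_ge_fast H.pulse_le_succ hs
  have hμ := hP.μ_pos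
  have he : w + (P.θg - 1) * (P.E + P.U) ≤ b - Y.pulse r + P.e₁ := by
    unfold Params.e₁; linarith
  have h7 : (1 + P.μ) * (Y.pulse (r + 1) - Y.pulse r) ≤
      P.T / (1 + P.φ) + (b - Y.pulse r + P.e₁) := by linarith
  have h8 : Y.pulse (r + 1) - Y.pulse r ≤
      P.T / (1 + P.φ) / (1 + P.μ) + (b - Y.pulse r + P.e₁) := by
    refine le_of_mul_le_mul_left (h7.trans ?_) (by linarith : 0 < 1 + P.μ)
    rw [mul_add, mul_div_cancel₀ _ (by linarith)]
    have := hP.e₁_nonneg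
    nlinarith
  unfold Params.period
  rw [← div_div]
  linarith

/-- The bound `b` holds for all good members at once, so it advances by a full `period` each round
and no error accumulates. -/
lemma IsCluster.le_pulse_of_slow (H : IsCluster P f good hw run arrs) {r₁ : ℕ} (n : ℕ)
    (hs : ∀ i ∈ good, ∀ r, r₁ ≤ r → r ≤ r₁ + n →
      ∀ t ∈ Ico ((run i).start r) ((run i).start (r + 1)), (run i).mode t = 0) {b : ℝ}
    (hb : ∀ i ∈ good, b ≤ (run i).pulse r₁) :
    ∀ i ∈ good, b + n * P.period ≤ (run i).pulse (r₁ + n) := by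
  induction n with
  | zero => simpa using hb
  | succ n ih =>
    intro i hi
    have ih' := ih fun i hi r h1 h2 => hs i hi r h1 (by omega)
    have := (H.heard (H i hi) (r₁ + n)).le_pulse_succ_of_slow ih' (ih' i hi) ?_
    · rw [← add_assoc]; push_cast; linarith
    · intro t ht
      have h1 := (H i hi).driven.start_le_pulse (r₁ + n)
      have h2 := ((H i hi).driven.pulse_le_corr (r₁ + n + 1)).trans_lt
        ((H i hi).driven.corr_lt_start (r₁ + n + 1))
      -- The time between two pulses straddles two rounds; both have the required mode.
      rcases lt_or_ge t ((run i).start (r₁ + n + 1)) with h | h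
      · exact hs i hi (r₁ + n) (by omega) (by omega) t ⟨h1.trans ht.1, h⟩
      · exact hs i hi (r₁ + n + 1) (by omega) (by omega) t ⟨h, ht.2.trans h2⟩

lemma IsCluster.pulse_le_of_fast (H : IsCluster P f good hw run arrs) {r₁ : ℕ} (n : ℕ)
    (hs : ∀ i ∈ good, ∀ r, r₁ ≤ r → r ≤ r₁ + n →
      ∀ t ∈ Ico ((run i).start r) ((run i).start (r + 1)), (run i).mode t = 1) {b : ℝ}
    (hb : ∀ i ∈ good, (run i).pulse r₁ ≤ b) :
    ∀ i ∈ good, (run i).pulse (r₁ + n) ≤ b + n * P.period := by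
  induction n with
  | zero => simpa using hb
  | succ n ih =>
    intro i hi
    have ih' := ih fun i hi r h1 h2 => hs i hi r h1 (by omega)
    have := (H.heard (H i hi) (r₁ + n)).pulse_succ_le_of_fast ih' (ih' i hi) ?_
    · rw [← add_assoc]; push_cast; linarith
    · intro t ht
      have h1 := (H i hi).driven.start_le_pulse (r₁ + n)
      have h2 := ((H i hi).driven.pulse_le_corr (r₁ + n + 1)).trans_lt
        ((H i hi).driven.corr_lt_start (r₁ + n + 1))
      rcases lt_or_ge t ((run i).start (r₁ + n + 1)) with h | h
      · exact hs i hi (r₁ + n) (by omega) (by omega) t ⟨h1.trans ht.1, h⟩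
      · exact hs i hi (r₁ + n + 1) (by omega) (by omega) t ⟨h, ht.2.trans h2⟩

end Run

/-! ### Advance of uniform clusters over arbitrary time intervals -/

namespace Run

variable {m : ℕ} {P : Params} {f : ℕ} {good : Finset (Fin m)} {h : ℝ → ℝ}
  {Y : Run m} {hw : Fin m → ℝ → ℝ} {run : Fin m → Run m} {arrs : Fin m → Fin m → ℕ → ℝ}

/-- The advance of the clock of a steady run, relative to a clock of rate `pace`, over a time span
of a few rounds. -/
lemma Steady.abs_advance_le (H : Steady P f h Y) {a b : ℝ} (ha : 0 ≤ a) (hab : a ≤ b) {n : ℝ}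
    (hn : b - a ≤ n * P.T) :
    |(Y.L P h b - Y.L P h a) - P.pace * (b - a)| ≤ n * (3.6 * P.E) := by
  have hP := H.driven.adm
  have h1 := H.L_sub ha hab
  have h2 := mul_le_mul_of_nonneg_right hP.one_le_pace (sub_nonneg.2 hab)
  have h3 := mul_le_mul_of_nonneg_right hP.pace_le (sub_nonneg.2 hab)
  have h4 := mul_le_mul_of_nonneg_left hn hP.ε_pos.le
  have hn0 : 0 ≤ n := by
    by_contra h
    nlinarith [hP.T_pos]
  have h5 := mul_le_mul_of_nonneg_left hP.ε_mul_T_le hn0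
  norm_num at h5 ⊢
  rw [abs_le]
  constructor <;> linarith

/-- The rounds of a cluster member that lie well inside a time interval. -/
lemma IsCluster.inner_rounds (H : IsCluster P f good hw run arrs) {i : Fin m} (hi : i ∈ good)
    {a b : ℝ} (ha : 0 ≤ a) (hab : a ≤ b) :
    b - a ≤ 3 * P.T ∨ ∃ r n : ℕ, a ≤ (run i).pulse r ∧ (run i).pulse r - a ≤ 3 * P.T ∧
      (run i).pulse (r + n) ≤ b ∧ b - (run i).pulse (r + n) ≤ 2 * P.T ∧
      ∀ j ∈ good, a < (run j).start r ∧ (run j).start (r + n) < b := by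
  have S := H.steady (H i hi)
  obtain ⟨ra, ha1, ha2⟩ := S.exists_round ha
  obtain ⟨rb, hb1, hb2⟩ := S.exists_round (ha.trans hab)
  have D := (H i hi).driven
  rcases lt_or_ge rb (ra + 3) with hlt | hge
  · left
    have h1 := D.start_mono (show rb + 1 ≤ ra + 3 by omega)
    have h2 := S.start_succ_sub_le ra
    have h3 := S.start_succ_sub_le (ra + 1)
    have h4 := S.start_succ_sub_le (ra + 1 + 1)
    linarith
  · right
    obtain ⟨n, rfl⟩ := Nat.exists_eq_add_of_le hge
    -- Starting with round `ra + 2` ensures that every good member, and not only `i`, begins this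
    -- round after `a`.
    refine ⟨ra + 2, n, ?_, ?_, ?_, ?_, ?_⟩
    · linarith [D.start_mono (show ra + 1 ≤ ra + 2 by omega), D.start_le_pulse (ra + 2)]
    · have h2 := S.start_succ_sub_le ra
      have h3 := S.start_succ_sub_le (ra + 1)
      have h4 := S.start_succ_sub_le (ra + 2)
      have h5 := (D.pulse_le_corr (ra + 2)).trans (D.corr_le_start (ra + 2))
      linarith
    · have h5 := (D.pulse_le_corr (ra + 2 + n)).trans (D.corr_le_start (ra + 2 + n))
      rw [show ra + 2 + n + 1 = ra + 3 + n by omega] at h5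
      linarith
    · have h2 := S.start_succ_sub_le (ra + 2 + n)
      have h3 := S.start_succ_sub_le (ra + 3 + n)
      have h5 := D.start_le_pulse (ra + 2 + n)
      rw [show ra + 2 + n + 1 = ra + 3 + n by omega] at h2
      linarith
    · intro j hj
      have Dj := (H j hj).driven
      have hE := D.adm.E_pos
      have hd := D.adm.d_pos
      constructor
      · have h1 := abs_le.1 (H.close (ra + 1) i hi j hj)
        have h2 := Dj.corr_sub_pulse_ge (ra + 1)
        have h3 := Dj.corr_le_start (ra + 1)
        have h4 := D.start_le_pulse (ra + 1)
        simp only [add_assoc, Nat.reduceAdd] at h3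
        linarith
      · have h1 := abs_le.1 (H.close (ra + 2 + n) i hi j hj)
        have h2 := D.corr_sub_pulse_ge (ra + 2 + n)
        have h3 := D.corr_le_start (ra + 2 + n)
        have h4 := Dj.start_le_pulse (ra + 2 + n)
        rw [show ra + 2 + n + 1 = ra + 3 + n by omega] at h3
        linarith

/-- Between pulses `r` and `r + n` the clock advances by exactly `n T`, which takes at least `n`
periods minus `E`. The ends cost `3` and `2` rounds at `3.6 E` each, and `pace E ≤ 2 E` completes
`20 E`. -/
lemma IsCluster.advance_le_of_slow (H : IsCluster P f good hw run arrs) {i : Fin m} (hi : i ∈ good)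
    {a b : ℝ} (ha : 0 ≤ a) (hab : a ≤ b)
    (hs : ∀ j ∈ good, ∀ r, a < (run j).start r → (run j).start r < b →
      ∀ t ∈ Ico ((run j).start r) ((run j).start (r + 1)), (run j).mode t = 0) :
    ((run i).L P (hw i) b - (run i).L P (hw i) a) - P.pace * (b - a) ≤ 20 * P.E := by
  have S := H.steady (H i hi)
  have hP := (H i hi).driven.adm
  have hE := hP.E_pos
  rcases H.inner_rounds hi ha hab with h | ⟨r, n, h1, h2, h3, h4, h5⟩
  · have := abs_le.1 (S.abs_advance_le ha hab h)
    norm_num at this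
    linarith
  · have a1 := abs_le.1 (S.abs_advance_le ha h1 h2)
    have hmono : (run i).pulse r ≤ (run i).pulse (r + n) := by
      rcases Nat.eq_zero_or_pos n with rfl | hn
      · simp
      · linarith [S.driven.pulse_add_d_le (show r < r + n by omega), hP.d_pos]
    have a2 := abs_le.1 (S.abs_advance_le ((ha.trans h1).trans hmono) h3 h4)
    have a3 := H.le_pulse_of_slow n (r₁ := r) (b := (run i).pulse r - P.E)
      (fun j hj r' hr hr' => hs j hj r'
        ((h5 j hj).1.trans_le ((H j hj).driven.start_mono hr))
        (((H j hj).driven.start_mono hr').trans_lt (h5 j hj).2))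
      (fun j hj => by linarith [abs_le.1 (H.close r i hi j hj)]) i hi
    have a4 := S.driven.L_pulse r
    have a5 := S.driven.L_pulse (r + n)
    have a6 : P.pace * (n * P.period - P.E) ≤ P.pace * ((run i).pulse (r + n) - (run i).pulse r) :=
      mul_le_mul_of_nonneg_left (by linarith) (by linarith [hP.one_le_pace])
    have a7 : P.pace * (n * P.period) = n * P.T := by rw [← hP.pace_mul_period]; ring
    have a8 : P.pace * P.E ≤ 2 * P.E :=
      mul_le_mul_of_nonneg_right (by linarith [hP.pace_le, hP.ε_le]) hE.le
    push_cast at a5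
    norm_num at a1 a2
    linarith

lemma IsCluster.le_advance_of_fast (H : IsCluster P f good hw run arrs) {i : Fin m} (hi : i ∈ good)
    {a b : ℝ} (ha : 0 ≤ a) (hab : a ≤ b)
    (hs : ∀ j ∈ good, ∀ r, a < (run j).start r → (run j).start r < b →
      ∀ t ∈ Ico ((run j).start r) ((run j).start (r + 1)), (run j).mode t = 1) :
    -(20 * P.E) ≤ ((run i).L P (hw i) b - (run i).L P (hw i) a) - P.pace * (b - a) := by
  have S := H.steady (H i hi)
  have hP := (H i hi).driven.adm
  have hE := hP.E_pos
  rcases H.inner_rounds hi ha hab with h | ⟨r, n, h1, h2, h3, h4, h5⟩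
  · have := abs_le.1 (S.abs_advance_le ha hab h)
    norm_num at this
    linarith
  · have a1 := abs_le.1 (S.abs_advance_le ha h1 h2)
    have hmono : (run i).pulse r ≤ (run i).pulse (r + n) := by
      rcases Nat.eq_zero_or_pos n with rfl | hn
      · simp
      · linarith [S.driven.pulse_add_d_le (show r < r + n by omega), hP.d_pos]
    have a2 := abs_le.1 (S.abs_advance_le ((ha.trans h1).trans hmono) h3 h4)
    have a3 := H.pulse_le_of_fast n (r₁ := r) (b := (run i).pulse r + P.E)
      (fun j hj r' hr hr' => hs j hj r'
        ((h5 j hj).1.trans_le ((H j hj).driven.start_mono hr))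
        (((H j hj).driven.start_mono hr').trans_lt (h5 j hj).2))
      (fun j hj => by linarith [abs_le.1 (H.close r i hi j hj)]) i hi
    have a4 := S.driven.L_pulse r
    have a5 := S.driven.L_pulse (r + n)
    have a6 : P.pace * ((run i).pulse (r + n) - (run i).pulse r) ≤ P.pace * (n * P.period + P.E) :=
      mul_le_mul_of_nonneg_left (by linarith) (by linarith [hP.one_le_pace])
    have a7 : P.pace * (n * P.period) = n * P.T := by rw [← hP.pace_mul_period]; ring
    have a8 : P.pace * P.E ≤ 2 * P.E :=
      mul_le_mul_of_nonneg_right (by linarith [hP.pace_le, hP.ε_le]) hE.le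
    push_cast at a5
    norm_num at a1 a2
    linarith

end Run

/-- A barrier argument: if no member of a finite family of continuous functions can climb by `η`
while it is above the level `B` and all members are below `B + η`, then none ever climbs
above `B + η`. -/
lemma le_of_barrier {V : Type*} [Finite V] {x : V → ℝ → ℝ} {a b B η : ℝ}
    (hcont : ∀ v, ContinuousOn (x v) (Icc a b)) (h0 : ∀ v, x v a ≤ B)
    (step : ∀ v t₀ t₁, a ≤ t₀ → t₀ ≤ t₁ → t₁ ≤ b → (∀ t ∈ Ioo t₀ t₁, B ≤ x v t) →
      (∀ w, ∀ t ∈ Ico a t₁, x w t ≤ B + η) → x v t₁ - x v t₀ < η) :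
    ∀ v, ∀ t ∈ Icc a b, x v t ≤ B + η := by
  intro v t ht
  by_contra hlt
  push Not at hlt
  have hS : IsCompact (⋃ v, Icc a b ∩ x v ⁻¹' Ici (B + η)) := by
    refine isCompact_iUnion fun v => ?_
    exact isCompact_Icc.of_isClosed_subset
      ((hcont v).preimage_isClosed_of_isClosed isClosed_Icc isClosed_Ici) inter_subset_left
  -- `t₁` is the first time at which some member reaches `B + η`, and `t₀` below is the last time
  -- before it at which this member is at most `B`.
  obtain ⟨t₁, ht₁, hleast⟩ := hS.exists_isLeast ⟨t, mem_iUnion.2 ⟨v, ht, hlt.le⟩⟩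
  obtain ⟨u, hu, hxu⟩ := mem_iUnion.1 ht₁
  have hK : IsCompact (Icc a t₁ ∩ x u ⁻¹' Iic B) :=
    isCompact_Icc.of_isClosed_subset
      (((hcont u).mono (Icc_subset_Icc_right hu.2)).preimage_isClosed_of_isClosed isClosed_Icc
        isClosed_Iic) inter_subset_left
  obtain ⟨t₀, ⟨ht₀, hx₀⟩, hgreat⟩ := hK.exists_isGreatest ⟨a, ⟨le_rfl, hu.1⟩, h0 u⟩
  have := step u t₀ t₁ ht₀.1 ht₀.2 hu.2 ?_ ?_
  · have h1 : B + η ≤ x u t₁ := hxu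
    have h2 : x u t₀ ≤ B := hx₀
    linarith
  · intro τ hτ
    by_contra h
    have := hgreat ⟨⟨ht₀.1.trans hτ.1.le, hτ.2.le⟩, (not_le.1 h).le⟩
    linarith [hτ.1]
  · intro w τ hτ
    by_contra h
    have := hleast (mem_iUnion.2 ⟨w, ⟨hτ.1, hτ.2.le.trans hu.2⟩, (not_le.1 h).le⟩)
    linarith [hτ.2]

/-! ## Executions -/

namespace Execution

open Run

variable {𝒞 : Type*} {m : ℕ}

open Classical in
/-- The indices of the correct nodes of the cluster `C`. -/
def good (F : Set (𝒞 × Fin m)) (C : 𝒞) : Finset (Fin m) := Finset.univ.filter fun i => (C, i) ∉ F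

lemma mem_good {F : Set (𝒞 × Fin m)} {C : 𝒞} {i : Fin m} : i ∈ good F C ↔ (C, i) ∉ F := by
  simp [good]

/-- The standing assumptions on an execution. -/
structure Setup (P : Params) (𝒢 : SimpleGraph 𝒞) (f : ℕ) (F : Set (𝒞 × Fin m))
    (X : Execution 𝒞 m) : Prop where
  adm : P.Admissible
  many : 3 * f + 1 ≤ m
  faults : ∀ C : 𝒞, {i : Fin m | (C, i) ∈ F}.ncard ≤ f
  valid : X.IsValid P 𝒢 f F
  k_ge : 100 ≤ P.k
  c_ge : 2 ≤ P.c

variable {P : Params} {𝒢 : SimpleGraph 𝒞} {f : ℕ} {F : Set (𝒞 × Fin m)} {X : Execution 𝒞 m}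

namespace Setup

lemma quorum (S : Setup P 𝒢 f F X) (C : 𝒞) : m ≤ (good F C).card + f := by
  classical
  have h1 := S.faults C
  have h2 : {i : Fin m | (C, i) ∈ F} = ((good F C)ᶜ : Finset (Fin m)) := by
    ext i; simp [mem_good]
  rw [h2, Set.ncard_coe_finset, Finset.card_compl, Fintype.card_fin] at h1
  omega

lemma exists_good (S : Setup P 𝒢 f F X) (C : 𝒞) : ∃ i, i ∈ good F C := by
  have h1 := S.quorum C
  have h2 := S.many
  exact Finset.card_pos.1 (by omega)

lemma δ_ge (S : Setup P 𝒢 f F X) : 105 * P.E ≤ P.δ := by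
  have h : (100 : ℝ) ≤ P.k := by exact_mod_cast S.k_ge
  unfold Params.δ
  exact mul_le_mul_of_nonneg_right (by linarith) S.adm.E_pos.le

lemma δ_pos (S : Setup P 𝒢 f F X) : 0 < P.δ := by
  linarith [S.δ_ge, S.adm.E_pos]

lemma driven_run (S : Setup P 𝒢 f F X) {v : 𝒞 × Fin m} (hv : v ∉ F) :
    Driven P f (X.hw v) (X.run v) :=
  ⟨S.adm, S.valid.hw_loc v hv, S.valid.hw_mem v hv, S.valid.run_follows v hv⟩

lemma isCluster (S : Setup P 𝒢 f F X) (C : 𝒞) :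
    IsCluster P f (good F C) (fun i => X.hw (C, i)) (fun i => X.run (C, i))
      fun j i => X.arr (C, j) (C, i) := by
  intro i hi
  rw [mem_good] at hi
  refine ⟨S.driven_run hi, S.many, S.quorum C, ?_, ?_, ?_, ?_⟩
  · exact fun j hj r r' hr => (S.driven_run (mem_good.1 hj)).pulse_add_d_le hr
  · intro j hj r
    refine S.valid.arr_mem _ (mem_good.1 hj) _ hi ?_ r
    by_cases hij : j = i
    · left; rw [hij]
    · exact Or.inr (Or.inr ⟨rfl, fun h => hij (congrArg Prod.snd h)⟩)
  · exact fun j hj r => S.valid.run_obs _ hi j (mem_good.1 hj) r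
  · exact fun r => Or.inr ⟨i, mem_good.2 hi, S.valid.run_self _ hi r, rfl⟩

lemma listener_sim (S : Setup P 𝒢 f F X) {v : 𝒞 × Fin m} (hv : v ∉ F) {A : 𝒞}
    (hA : 𝒢.Adj v.1 A) :
    Listener P f (good F A) (fun j => (X.run (A, j)).pulse) (X.hw v) (X.sim v A)
      fun j => X.arr (A, j) v := by
  refine ⟨⟨S.adm, S.valid.hw_loc v hv, S.valid.hw_mem v hv, S.valid.sim_follows v hv A hA⟩,
    S.many, S.quorum A, ?_, ?_, ?_, ?_⟩
  · exact fun j hj r r' hr => (S.driven_run (mem_good.1 hj)).pulse_add_d_le hr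
  · exact fun j hj r => S.valid.arr_mem _ (mem_good.1 hj) _ hv (Or.inr (Or.inl hA.symm)) r
  · exact fun j hj r => S.valid.sim_obs _ hv A hA j (mem_good.1 hj) r
  · exact fun r => Or.inl (S.valid.sim_self v hv A hA r)

lemma steady (S : Setup P 𝒢 f F X) {v : 𝒞 × Fin m} (hv : v ∉ F) :
    Steady P f (X.hw v) (X.run v) :=
  (S.isCluster v.1).steady (S.isCluster v.1 v.2 (mem_good.2 hv))

lemma L_sub (S : Setup P 𝒢 f F X) {v : 𝒞 × Fin m} (hv : v ∉ F) {a b : ℝ} (ha : 0 ≤ a)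
    (hab : a ≤ b) : b - a ≤ X.L P v b - X.L P v a ∧
      X.L P v b - X.L P v a ≤ (1 + 6 * P.ε) * (b - a) :=
  (S.steady hv).L_sub ha hab

lemma L_zero (P : Params) (X : Execution 𝒞 m) (v : 𝒞 × Fin m) : X.L P v 0 = 0 :=
  Driven.L_zero _ _ _

lemma L_continuousOn (S : Setup P 𝒢 f F X) {v : 𝒞 × Fin m} (hv : v ∉ F) :
    ContinuousOn (X.L P v) (Ici 0) := (S.steady hv).L_continuousOn

lemma L_cluster (S : Setup P 𝒢 f F X) {v w : 𝒞 × Fin m} (hv : v ∉ F) (hw : w ∉ F)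
    (hvw : v.1 = w.1) {t : ℝ} (ht : 0 ≤ t) : |X.L P v t - X.L P w t| ≤ 10 * P.E := by
  obtain ⟨C, i⟩ := v
  obtain ⟨C', j⟩ := w
  obtain rfl : C = C' := hvw
  exact (S.isCluster C).L_close (S.isCluster C i (mem_good.2 hv)) (mem_good.2 hw) ht

lemma Lest_close (S : Setup P 𝒢 f F X) {v : 𝒞 × Fin m} (hv : v ∉ F) {A : 𝒞}
    (hA : 𝒢.Adj v.1 A) {i : Fin m} (hi : (A, i) ∉ F) {t : ℝ} (ht : 0 ≤ t) :
    |X.Lest P v A t - X.L P (A, i) t| ≤ 10 * P.E :=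
  (S.isCluster A).L_close (S.listener_sim hv hA) (mem_good.2 hi) ht

/-! ### Modes -/

/-- The fast trigger needs an estimate at least `2 κ - δ = 5 δ` ahead, but none is ahead by more
than `δ + 20 E`. Catching up needs a distance `c δ ≥ 2 δ` below `M`. -/
lemma chosenMode_eq_zero (S : Setup P 𝒢 f F X) {v : 𝒞 × Fin m} (hv : v ∉ F) {t B : ℝ} (ht : 0 ≤ t)
    (hB : ∀ w ∉ F, X.L P w t ≤ B) (hvB : B - P.δ - 10 * P.E ≤ X.L P v t) (hM : X.M v t ≤ B) :
    X.chosenMode P 𝒢 v t = 0 := by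
  have hδ := S.δ_ge
  have hE := S.adm.E_pos
  have hfast : ¬ X.FastTrigger P 𝒢 v t := by
    rintro ⟨s, hs, ⟨A, hA, hle⟩, -⟩
    obtain ⟨i, hi⟩ := S.exists_good A
    rw [mem_good] at hi
    have h1 := abs_le.1 (S.Lest_close hv hA hi ht)
    have h2 := hB _ hi
    have hs' : (1 : ℝ) ≤ s := by exact_mod_cast hs
    unfold Params.κ at hle
    nlinarith
  unfold chosenMode
  rw [if_neg hfast]
  split_ifs with h1 h2
  · rfl
  · have := mul_le_mul_of_nonneg_right S.c_ge S.δ_pos.le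
    linarith
  · rfl

/-- The slow trigger needs an estimate at least `κ - δ = 2 δ` behind, but none is behind by more
than `δ + 20 E`. So the catch-up rule or the fast trigger decides. -/
lemma chosenMode_eq_one (S : Setup P 𝒢 f F X) {v : 𝒞 × Fin m} (hv : v ∉ F) {t B : ℝ} (ht : 0 ≤ t)
    (hB : ∀ w ∉ F, B ≤ X.L P w t) (hvB : X.L P v t ≤ B + P.δ + 10 * P.E)
    (hM : X.L P v t ≤ X.M v t - P.c * P.δ) :
    X.chosenMode P 𝒢 v t = 1 := by
  have hδ := S.δ_ge
  have hE := S.adm.E_pos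
  have hslow : ¬ X.SlowTrigger P 𝒢 v t := by
    rintro ⟨s, hs, ⟨A, hA, hle⟩, -⟩
    obtain ⟨i, hi⟩ := S.exists_good A
    rw [mem_good] at hi
    have h1 := abs_le.1 (S.Lest_close hv hA hi ht)
    have h2 := hB _ hi
    have hs' : (1 : ℝ) ≤ s := by exact_mod_cast hs
    unfold Params.κ at hle
    nlinarith
  unfold chosenMode
  rw [if_neg hslow, if_pos hM]
  split_ifs <;> rfl

/-- The clock values grow at a rate of at most `pace`, up to an additive error. -/
lemma L_le_of_M_le (S : Setup P 𝒢 f F X) [Finite 𝒞]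
    (hM : ∀ t, 0 ≤ t → ∀ v ∉ F, ∃ w ∉ F, X.M v t ≤ X.L P w t) {a b B : ℝ} (ha : 0 ≤ a)
    (hab : a ≤ b) (hB : ∀ v ∉ F, X.L P v a - P.pace * a ≤ B) :
    ∀ v ∉ F, X.L P v b - P.pace * b ≤ B + P.δ := by
  have hδ := S.δ_ge
  have hE := S.adm.E_pos
  intro v hv
  refine le_of_barrier (V := {v : 𝒞 × Fin m // v ∉ F})
    (x := fun v t => X.L P v.1 t - P.pace * t) (a := a) (b := b) ?_ (fun v => hB v.1 v.2) ?_
    ⟨v, hv⟩ b ⟨hab, le_rfl⟩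
  · intro v
    exact ((S.L_continuousOn v.2).mono fun t ht => ha.trans ht.1).sub
      (continuous_const.mul continuous_id).continuousOn
  · rintro ⟨v, hv⟩ t₀ t₁ h0 h01 h1 habove hbelow
    -- While `v` is above the level `B`, its whole cluster is within `δ + 10 E` of the barrier and
    -- chooses slow mode; it gains at most `20 E < δ`.
    have := (S.isCluster v.1).advance_le_of_slow (mem_good.2 hv) (ha.trans h0) h01 ?_
    · change X.L P v t₁ - X.L P v t₀ - _ ≤ _ at this
      change X.L P v t₁ - P.pace * t₁ - (X.L P v t₀ - P.pace * t₀) < P.δ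
      linarith
    · intro j hj r hr0 hr1 t ht
      rw [mem_good] at hj
      rw [S.valid.mode_eq _ hj r t ht]
      set τ := (X.run (v.1, j)).start r
      have hτ : 0 ≤ τ := by linarith
      have hall : ∀ w ∉ F, X.L P w τ ≤ B + P.δ + P.pace * τ := by
        intro w hw
        linarith [hbelow ⟨w, hw⟩ τ ⟨by linarith, hr1⟩]
      refine S.chosenMode_eq_zero hj hτ hall ?_ ?_
      · have h1 := habove τ ⟨hr0, hr1⟩
        have h2 := abs_le.1 (S.L_cluster hv hj rfl hτ)
        simp only at h1
        linarith
      · obtain ⟨w, hw, hle⟩ := hM τ hτ _ hj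
        exact hle.trans (hall w hw)

/-- While the skew is large, the clock values grow at a rate of at least `pace`, up to an additive
error. -/
lemma le_L_of_skew (S : Setup P 𝒢 f F X) [Finite 𝒞] {η : ℝ}
    (hM : ∀ t, 0 ≤ t → ∀ v ∉ F, ∀ w ∉ F, X.L P w t ≤ X.M v t + η) {a b B : ℝ} (ha : 0 ≤ a)
    (hab : a ≤ b) (hB : ∀ v ∉ F, B ≤ X.L P v a - P.pace * a)
    (hskew : ∀ t, a < t → t ≤ b → ∃ v ∉ F, ∃ w ∉ F,
      η + (P.c + 2) * P.δ < X.L P v t - X.L P w t) :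
    ∀ v ∉ F, B - P.δ ≤ X.L P v b - P.pace * b := by
  have hδ := S.δ_ge
  have hE := S.adm.E_pos
  intro v hv
  suffices P.pace * b - X.L P v b ≤ -B + P.δ by linarith
  refine le_of_barrier (V := {v : 𝒞 × Fin m // v ∉ F})
    (x := fun v t => P.pace * t - X.L P v.1 t) (a := a) (b := b) ?_
    (fun v => by linarith [hB v.1 v.2]) ?_ ⟨v, hv⟩ b ⟨hab, le_rfl⟩
  · intro v
    exact (continuous_const.mul continuous_id).continuousOn.sub
      ((S.L_continuousOn v.2).mono fun t ht => ha.trans ht.1)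
  · rintro ⟨v, hv⟩ t₀ t₁ h0 h01 h1 habove hbelow
    have := (S.isCluster v.1).le_advance_of_fast (mem_good.2 hv) (ha.trans h0) h01 ?_
    · change _ ≤ X.L P v t₁ - X.L P v t₀ - _ at this
      change P.pace * t₁ - X.L P v t₁ - (P.pace * t₀ - X.L P v t₀) < P.δ
      linarith
    · intro j hj r hr0 hr1 t ht
      rw [mem_good] at hj
      rw [S.valid.mode_eq _ hj r t ht]
      set τ := (X.run (v.1, j)).start r
      have hτ : 0 ≤ τ := by linarith
      have hall : ∀ w ∉ F, B - P.δ + P.pace * τ ≤ X.L P w τ := by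
        intro w hw
        linarith [hbelow ⟨w, hw⟩ τ ⟨by linarith, hr1⟩]
      have hj1 : X.L P (v.1, j) τ ≤ B + P.pace * τ + 10 * P.E := by
        have h1 := habove τ ⟨hr0, hr1⟩
        have h2 := abs_le.1 (S.L_cluster hv hj rfl hτ)
        simp only at h1
        linarith
      refine S.chosenMode_eq_one hj hτ hall (by linarith) ?_
      -- The clock of `u` is more than `η + (c + 2) δ` above that of `w`, which is at most `δ` below
      -- the level. So `M` exceeds the level by `(c + 1) δ`, and the catch-up rule applies.
      obtain ⟨u, hu, w, hw, huw⟩ := hskew τ (by linarith) (by linarith)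
      have h3 := hM τ hτ _ hj u hu
      have h4 := hall w hw
      linarith

/-! ### Estimates of the maximum clock -/

lemma int_hw (S : Setup P 𝒢 f F X) {v : 𝒞 × Fin m} (hv : v ∉ F) {a b : ℝ} (hab : a ≤ b) :
    b - a ≤ ∫ τ in a..b, X.hw v τ ∧ ∫ τ in a..b, X.hw v τ ≤ (1 + P.ρ) * (b - a) := by
  have hi : IntervalIntegrable (X.hw v) volume a b :=
    ((S.valid.hw_loc v hv).integrableOn_isCompact isCompact_uIcc).intervalIntegrable
  constructor
  · calc b - a = ∫ _ in a..b, (1 : ℝ) := by simp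
      _ ≤ _ := intervalIntegral.integral_mono_on hab (by simp) hi
        fun t _ => (S.valid.hw_mem v hv t).1
  · calc _ ≤ ∫ _ in a..b, (1 + P.ρ) := intervalIntegral.integral_mono_on hab hi (by simp)
          fun t _ => (S.valid.hw_mem v hv t).2
      _ = _ := by rw [intervalIntegral.integral_const, smul_eq_mul, mul_comm]

lemma le_M (S : Setup P 𝒢 f F X) {v : 𝒞 × Fin m} (hv : v ∉ F) {s t y : ℝ} (hs : 0 ≤ s)
    (hst : s ≤ t) (hy : y ∈ X.raiseTo P 𝒢 f v s) : y + (t - s) / (1 + P.ρ) ≤ X.M v t := by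
  have hρ := S.adm.ρ_pos
  refine le_trans ?_ ((S.valid.M_lub v hv t (hs.trans hst)).1 ⟨s, ⟨hs, hst⟩, y, hy, rfl⟩)
  have := div_le_div_of_nonneg_right (S.int_hw hv hst).1 (by linarith : 0 ≤ 1 + P.ρ)
  linarith

lemma L_le_M (S : Setup P 𝒢 f F X) {v : 𝒞 × Fin m} (hv : v ∉ F) {t : ℝ} (ht : 0 ≤ t) :
    X.L P v t ≤ X.M v t := by
  have := S.le_M hv ht le_rfl (Or.inl rfl)
  simpa using this

lemma exists_of_registered (S : Setup P 𝒢 f F X) {v : 𝒞 × Fin m} (hv : v ∉ F) {j : ℕ} (hj : 1 ≤ j)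
    {s : ℝ} (hr : X.Registered 𝒢 f v j s) :
    ∃ u ∉ F, ∃ q, 0 ≤ q ∧ q ≤ s - (P.d - P.U) ∧ j * (P.d - P.U) ≤ X.M u q := by
  obtain ⟨A, hA, I, hI, hcount⟩ := hr
  have hgood : ∃ i ∈ I, (A, i) ∉ F := by
    by_contra hbad
    push Not at hbad
    have h1 : (I : Set (Fin m)) ⊆ {i | (A, i) ∈ F} := fun i hi => hbad i hi
    have h2 := Set.ncard_le_ncard h1 (Set.toFinite _)
    rw [Set.ncard_coe_finset, hI] at h2
    linarith [S.faults A]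
  obtain ⟨i, hi, hiF⟩ := hgood
  -- Pulses are indexed from `0`, so `j` received pulses include one with index at least `j - 1`,
  -- sent when the estimate had reached `j (d - U)`.
  have hl : ∃ l, j ≤ l + 1 ∧ X.floodRecv (A, i) v l ≤ (s : WithTop ℝ) := by
    by_contra hno
    push Not at hno
    have h1 : {l | X.floodRecv (A, i) v l ≤ (s : WithTop ℝ)} ⊆ (Finset.range (j - 1) : Set ℕ) := by
      intro l hl
      rw [Finset.mem_coe, Finset.mem_range]
      by_contra hlt
      exact absurd hl (not_le.2 (hno l (by omega)))
    have h2 := Set.encard_le_encard h1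
    rw [Set.encard_coe_eq_coe_finsetCard, Finset.card_range] at h2
    have h3 : (j : ℕ∞) ≤ ((j - 1 : ℕ) : ℕ∞) := (hcount i hi).trans h2
    have h4 : j ≤ j - 1 := by exact_mod_cast h3
    omega
  obtain ⟨l, hjl, hl⟩ := hl
  obtain ⟨t, ht, hrecv⟩ := S.valid.floodRecv_mem _ hiF v hv (Or.inl hA.symm) l
  rw [hrecv, WithTop.coe_le_coe] at hl
  have hsend := (S.valid.floodSend_at _ hiF l).1
  refine ⟨(A, i), hiF, X.floodSend (A, i) l, hsend.1, by linarith [ht.1], le_trans ?_ hsend.2⟩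
  have : (j : ℝ) ≤ l + 1 := by exact_mod_cast hjl
  exact mul_le_mul_of_nonneg_right this (by linarith [S.adm.U_lt_d])

/-- The estimates do not exceed the maximum clock value. -/
lemma M_le_L (S : Setup P 𝒢 f F X) [Finite 𝒞] {t : ℝ} (ht : 0 ≤ t) :
    ∀ v ∉ F, ∃ w ∉ F, X.M v t ≤ X.L P w t := by
  have hd : 0 < P.d - P.U := sub_pos.2 S.adm.U_lt_d
  have hρ := S.adm.ρ_pos
  obtain ⟨n, hn⟩ := Archimedean.arch t hd
  rw [nsmul_eq_mul] at hn
  replace hn : t < (n + 1 : ℕ) * (P.d - P.U) := by push_cast; linarith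
  -- Induction over time slices of length `d - U`: a registered pulse was sent at least one slice
  -- earlier. In the meantime the maximum clock has gained `d - U`, which pays for the raise from
  -- `j` to `j + 1`.
  generalize n + 1 = n at hn
  induction n generalizing t with
  | zero => simp at hn; linarith
  | succ n ih =>
    intro v hv
    have : Nonempty {v : 𝒞 × Fin m // v ∉ F} := ⟨⟨v, hv⟩⟩
    obtain ⟨⟨w, hw⟩, hmax⟩ := Finite.exists_max fun w : {v : 𝒞 × Fin m // v ∉ F} => X.L P w.1 t
    refine ⟨w, hw, (S.valid.M_lub v hv t ht).2 ?_⟩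
    rintro x ⟨s, hs, y, hy, rfl⟩
    have hg : (∫ τ in s..t, X.hw v τ) / (1 + P.ρ) ≤ t - s := by
      rw [div_le_iff₀ (by linarith)]
      linarith [(S.int_hw hv hs.2).2]
    rcases hy with rfl | ⟨j, hj, hreg, rfl⟩
    · have h1 := (S.L_sub hv hs.1 hs.2).1
      have h2 := hmax ⟨v, hv⟩
      simp only at h2
      linarith
    · obtain ⟨u, hu, q, hq0, hq, hMu⟩ := S.exists_of_registered hv hj hreg
      obtain ⟨w', hw', hle⟩ := ih hq0 (by push_cast at hn; linarith [hs.2]) u hu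
      have h1 := (S.L_sub hw' hq0 (by linarith [hs.2] : q ≤ t)).1
      have h2 := hmax ⟨w', hw'⟩
      simp only at h2
      linarith

lemma floodSend_le (S : Setup P 𝒢 f F X) {u : 𝒞 × Fin m} (hu : u ∉ F) {q : ℝ} (hq : 0 ≤ q) {j : ℕ}
    (hM : j * (P.d - P.U) ≤ X.M u q) {l : ℕ} (hl : l < j) : X.floodSend u l ≤ q := by
  refine (S.valid.floodSend_at u hu l).2 ⟨hq, le_trans ?_ hM⟩
  have : (l : ℝ) + 1 ≤ j := by exact_mod_cast hl
  exact mul_le_mul_of_nonneg_right this (by linarith [S.adm.U_lt_d])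

/-- A flooding pulse of a whole cluster is registered in the adjacent clusters. -/
lemma registered_of_le (S : Setup P 𝒢 f F X) {C : 𝒞} {q : ℝ} (hq : 0 ≤ q) {j : ℕ}
    (hM : ∀ i ∈ good F C, j * (P.d - P.U) ≤ X.M (C, i) q) {v : 𝒞 × Fin m} (hv : v ∉ F)
    (hC : 𝒢.Adj v.1 C) : X.Registered 𝒢 f v j (q + P.d) := by
  have h1 := S.quorum C
  have h2 := S.many
  obtain ⟨I, hI, hcard⟩ := Finset.exists_subset_card_eq (show f + 1 ≤ (good F C).card by omega)
  refine ⟨C, hC, I, hcard, fun i hi => ?_⟩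
  have hiF := mem_good.1 (hI hi)
  have hsub : (Finset.range j : Set ℕ) ⊆
      {l | X.floodRecv (C, i) v l ≤ ((q + P.d : ℝ) : WithTop ℝ)} := by
    intro l hl
    rw [Finset.mem_coe, Finset.mem_range] at hl
    obtain ⟨t, ht, hrecv⟩ := S.valid.floodRecv_mem _ hiF v hv (Or.inl hC.symm) l
    rw [mem_ofPred_eq, hrecv, WithTop.coe_le_coe]
    linarith [ht.2, S.floodSend_le hiF hq (hM i (hI hi)) hl]
  have := Set.encard_le_encard hsub
  rwa [Set.encard_coe_eq_coe_finsetCard, Finset.card_range] at this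

/-- Flooding along a walk. -/
lemma registered_of_walk (S : Setup P 𝒢 f F X) {n : ℕ} {C A : 𝒞} (p : 𝒢.Walk C A)
    (hp : p.length = n + 1) {q : ℝ} (hq : 0 ≤ q) {j : ℕ} (hj : 1 ≤ j)
    (hM : ∀ i ∈ good F C, j * (P.d - P.U) ≤ X.M (C, i) q) {v : 𝒞 × Fin m} (hv : v ∉ F)
    (hA : v.1 = A) : X.Registered 𝒢 f v (j + n) (q + (n + 1) * P.d) := by
  induction n generalizing C q j with
  | zero =>
    cases p with
    | nil => simp at hp
    | cons hadj p' =>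
      rw [SimpleGraph.Walk.length_cons, zero_add, Nat.add_eq_right] at hp
      have := SimpleGraph.Walk.eq_of_length_eq_zero hp
      subst this
      subst hA
      simpa using S.registered_of_le hq hM hv hadj.symm
  | succ n ih =>
    cases p with
    | nil => simp at hp
    | @cons _ B _ hadj p' =>
      rw [SimpleGraph.Walk.length_cons] at hp
      have hqd : 0 ≤ q + P.d := by linarith [S.adm.d_pos]
      -- After one delay all correct members of the next cluster have raised their estimates to
      -- level `j + 1`, and flooding continues from there.
      have := ih p' (by omega) hqd (j := j + 1) (by omega) (fun i hi => ?_)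
      · rw [show j + 1 + n = j + (n + 1) by omega] at this
        convert this using 1
        push_cast; ring
      · have hiF := mem_good.1 hi
        have h1 := S.registered_of_le hq hM hiF hadj.symm
        have h2 := S.le_M hiF hqd le_rfl (Or.inr ⟨j, hj, h1, rfl⟩)
        push_cast
        simpa using h2

/-- The estimates lag behind the maximum clock value by at most `O(E)` per hop. -/
lemma L_le_M_add (S : Setup P 𝒢 f F X) {v w : 𝒞 × Fin m} (hv : v ∉ F) (hw : w ∉ F)
    (p : 𝒢.Walk w.1 v.1) {t : ℝ} (ht : 0 ≤ t) :
    X.L P w t ≤ X.M v t + (2 * p.length + 12) * P.E := by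
  have hP := S.adm
  have hE := hP.E_pos
  have hε := hP.ε_pos
  have hd := hP.d_pos
  have hU := hP.U_nonneg
  have hD : 0 < P.d - P.U := sub_pos.2 hP.U_lt_d
  have hρ := hP.ρ_pos
  have hρε := hP.ρ_le
  have hεd := hP.ε_mul_d_le
  have hinv : 1 - P.ρ ≤ 1 / (1 + P.ρ) := by
    rw [le_div_iff₀ (by linarith)]; nlinarith
  have hgrow : ∀ x, 0 ≤ x → x - P.ρ * x ≤ x / (1 + P.ρ) := by
    intro x hx
    have := mul_le_mul_of_nonneg_left hinv hx
    rw [mul_one_div] at this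
    linarith
  obtain ⟨n, hn⟩ : ∃ n, p.length = n := ⟨_, rfl⟩
  rw [hn]
  cases n with
  | zero =>
    have h1 := SimpleGraph.Walk.eq_of_length_eq_zero hn
    have h2 := abs_le.1 (S.L_cluster hw hv h1 ht)
    have h3 := S.L_le_M hv ht
    push_cast
    linarith
  | succ n =>
    have hn0 : (0 : ℝ) ≤ n := Nat.cast_nonneg n
    have hnE : 0 ≤ n * P.E := mul_nonneg hn0 hE.le
    have hnεd : 4096 * (n * (P.ε * P.d)) ≤ n * P.E := by
      have := mul_le_mul_of_nonneg_left hεd hn0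
      linarith
    have hεE : P.ε * P.E ≤ P.E / 1000000 := by nlinarith [hP.ε_le]
    have hnU : 10000 * (n * P.U) ≤ n * P.E := by
      have := mul_le_mul_of_nonneg_left hP.U_le hn0
      linarith
    have hUE := hP.U_le
    -- For small `t` flooding is not needed: `M` grows at rate at least `1 / (1 + ρ)` from the
    -- start, so the lag is mere drift.
    have early : t ≤ (n + 3) * P.d + 10 * P.E →
        X.L P w t ≤ X.M v t + (2 * (n + 1 : ℕ) + 12) * P.E := by
      intro hle
      have h1 := (S.L_sub hw le_rfl ht).2
      have h2 := S.le_M hv le_rfl ht (Or.inl rfl)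
      rw [L_zero] at h1 h2
      have h3 := hgrow (t - 0) (by linarith)
      have h4 := mul_le_mul_of_nonneg_left hle hε.le
      have h5 : P.ρ * t ≤ P.ε * t := mul_le_mul_of_nonneg_right (by linarith) ht
      push_cast
      linarith
    by_cases hle : t ≤ (n + 3) * P.d + 10 * P.E
    · exact early hle
    push Not at hle
    have hndnn : 0 ≤ n * P.d := mul_nonneg hn0 hd.le
    have ht' : 0 ≤ t - (n + 1) * P.d := by linarith
    have h1 := (S.L_sub hw le_rfl ht').1
    rw [L_zero] at h1
    -- The floor `j` of `a` is the highest level that the whole cluster of `w` has surely reached,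
    -- in view of its spread `10 E`, early enough for `n + 1` hops to be completed by time `t`.
    set a := (X.L P w (t - (n + 1) * P.d) - 10 * P.E) / (P.d - P.U) with ha
    have ha1 : 1 ≤ a := by
      rw [ha, le_div_iff₀ hD]; linarith
    set j := ⌊a⌋₊ with hj
    have hj1 : 1 ≤ j := Nat.le_floor (by simpa using ha1)
    have hj2 : (j : ℝ) * (P.d - P.U) ≤ X.L P w (t - (n + 1) * P.d) - 10 * P.E := by
      rw [← le_div_iff₀ hD]; exact Nat.floor_le (by linarith)
    have hj3 : X.L P w (t - (n + 1) * P.d) - 10 * P.E ≤ (j + 1) * (P.d - P.U) := by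
      rw [← div_le_iff₀ hD]; exact (Nat.lt_floor_add_one a).le
    have hjD : 0 ≤ (j : ℝ) * (P.d - P.U) := mul_nonneg (Nat.cast_nonneg j) hD.le
    obtain ⟨q, hq, hLq⟩ := intermediate_value_Icc ht'
      ((S.L_continuousOn hw).mono fun x hx => hx.1)
      (show (j : ℝ) * (P.d - P.U) + 10 * P.E ∈ Icc (X.L P w 0) (X.L P w (t - (n + 1) * P.d)) from
        ⟨by rw [L_zero]; linarith, by linarith⟩)
    have h2 := (S.L_sub hw hq.1 hq.2).1
    have hqt : q + (n + 1) * P.d ≤ t := by linarith [hq.2]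
    -- Flooding starts at the time `q` at which level `j` is surely reached. Each hop loses `U` and
    -- some drift, both far below `E`.
    have hreg := S.registered_of_walk p hn hq.1 hj1 (fun i hi => ?_) hv rfl
    · have h3 := S.le_M hv (by linarith [hq.1] : 0 ≤ q + (n + 1) * P.d) hqt
        (Or.inr ⟨j + n, by omega, hreg, rfl⟩)
      have h4 := hgrow (t - (q + (n + 1) * P.d)) (by linarith)
      have h5 := (S.L_sub hw hq.1 (by linarith : q ≤ t)).2
      have h6 : t - (q + (n + 1) * P.d) ≤ P.d := by linarith
      have h7 := mul_le_mul_of_nonneg_left h6 hρ.le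
      have h8 : P.ε * (t - q) ≤ P.ε * ((n + 2) * P.d) :=
        mul_le_mul_of_nonneg_left (by linarith) hε.le
      have h9 : P.ρ * P.d ≤ P.ε * P.d := mul_le_mul_of_nonneg_right (by linarith) hd.le
      push_cast at h3 ⊢
      linarith
    · have hiF := mem_good.1 hi
      have h3 := abs_le.1 (S.L_cluster hw hiF rfl hq.1)
      have h4 := S.L_le_M hiF hq.1
      linarith

end Setup

end Execution

/-! ## Distances in the augmented network -/

variable {𝒞 : Type*} {𝒢 : SimpleGraph 𝒞} {m : ℕ}

lemma exists_walk_of_augmented {v w : 𝒞 × Fin m} (p : (augmented 𝒢 m).Walk v w) :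
    ∃ p' : 𝒢.Walk v.1 w.1, p'.length ≤ p.length := by
  induction p with
  | nil => exact ⟨.nil, le_rfl⟩
  | @cons u v w hadj p ih =>
    obtain ⟨p', hp'⟩ := ih
    rw [SimpleGraph.Walk.length_cons]
    rcases hadj with h | ⟨h, -⟩
    · exact ⟨.cons h p', by rw [SimpleGraph.Walk.length_cons]; omega⟩
    · exact ⟨p'.copy h.symm rfl, by rw [SimpleGraph.Walk.length_copy]; omega⟩

lemma augmented_reachable {C A : 𝒞} (p : 𝒢.Walk C A) (i j : Fin m) :
    (augmented 𝒢 m).Reachable (C, i) (A, j) := by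
  induction p with
  | nil =>
    by_cases hij : i = j
    · rw [hij]
    · exact SimpleGraph.Adj.reachable (Or.inr ⟨rfl, fun h => hij (congrArg Prod.snd h)⟩)
  | @cons C B A hadj p ih =>
    exact (SimpleGraph.Adj.reachable (show (augmented 𝒢 m).Adj (C, i) (B, i) from Or.inl hadj)).trans
      ih

/-- The clusters of two nodes are connected by a walk no longer than the diameter of the network,
which is positive if the nodes are distinct. -/
lemma exists_walk_le_diam [Finite 𝒞] (hconn : 𝒢.Connected) (v w : 𝒞 × Fin m) :
    (∃ p : 𝒢.Walk v.1 w.1, p.length ≤ (augmented 𝒢 m).diam) ∧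
      (v ≠ w → 1 ≤ (augmented 𝒢 m).diam) := by
  have : Nonempty (𝒞 × Fin m) := ⟨v⟩
  have hc : (augmented 𝒢 m).Connected := by
    refine SimpleGraph.Connected.mk fun a b => ?_
    obtain ⟨p⟩ := hconn.preconnected a.1 b.1
    exact augmented_reachable p a.2 b.2
  have hd : (augmented 𝒢 m).dist v w ≤ (augmented 𝒢 m).diam :=
    SimpleGraph.dist_le_diam (SimpleGraph.connected_iff_ediam_ne_top.1 hc)
  constructor
  · obtain ⟨p, hp⟩ := hc.exists_walk_length_eq_dist v w
    obtain ⟨p', hp'⟩ := exists_walk_of_augmented p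
    exact ⟨p', by omega⟩
  · intro hvw
    have := hc.pos_dist_of_ne hvw
    omega

/-! ### The global skew -/

namespace Execution.Setup

variable {P : Params} {f : ℕ} {F : Set (𝒞 × Fin m)} {X : Execution 𝒞 m}

/-- The last time at which the skew is at most `g`. -/
lemma exists_last_small (S : Setup P 𝒢 f F X) {g t : ℝ} (hg : 0 ≤ g) (ht : 0 ≤ t) :
    ∃ a ∈ Icc 0 t, (∀ v ∉ F, ∀ w ∉ F, X.L P v a - X.L P w a ≤ g) ∧
      ∀ τ, a < τ → τ ≤ t → ∃ v ∉ F, ∃ w ∉ F, g < X.L P v τ - X.L P w τ := by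
  have hclosed : IsCompact (Icc 0 t ∩ ⋂ v : {v // v ∉ F}, ⋂ w : {w // w ∉ F},
      Icc 0 t ∩ (fun τ => X.L P v.1 τ - X.L P w.1 τ) ⁻¹' Iic g) := by
    refine isCompact_Icc.inter_right (isClosed_iInter fun v => isClosed_iInter fun w => ?_)
    refine ContinuousOn.preimage_isClosed_of_isClosed ?_ isClosed_Icc isClosed_Iic
    exact ((S.L_continuousOn v.2).mono fun x hx => hx.1).sub
      ((S.L_continuousOn w.2).mono fun x hx => hx.1)
  have hmem : ∀ τ ∈ Icc 0 t, (∀ v ∉ F, ∀ w ∉ F, X.L P v τ - X.L P w τ ≤ g) →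
      τ ∈ Icc 0 t ∩ ⋂ v : {v // v ∉ F}, ⋂ w : {w // w ∉ F},
      Icc 0 t ∩ (fun τ => X.L P v.1 τ - X.L P w.1 τ) ⁻¹' Iic g := by
    intro τ hτ h
    exact ⟨hτ, mem_iInter.2 fun v => mem_iInter.2 fun w => ⟨hτ, h _ v.2 _ w.2⟩⟩
  obtain ⟨a, ha, hgreat⟩ := hclosed.exists_isGreatest
    ⟨0, hmem 0 ⟨le_rfl, ht⟩ fun v _ w _ => by rw [L_zero, L_zero, sub_zero]; exact hg⟩
  refine ⟨a, ha.1, fun v hv w hw => ?_, fun τ h1 h2 => ?_⟩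
  · exact (mem_iInter.1 (mem_iInter.1 ha.2 ⟨v, hv⟩) ⟨w, hw⟩).2
  · by_contra hno
    push Not at hno
    exact absurd (hgreat (hmem τ ⟨ha.1.1.trans h1.le, h2⟩ hno)) (not_le.2 h1)

/-- The bound on the global skew. -/
lemma skew_le (S : Setup P 𝒢 f F X) [Finite 𝒞] (hconn : 𝒢.Connected) {t : ℝ} (ht : 0 ≤ t)
    {v w : 𝒞 × Fin m} (hv : v ∉ F) (hw : w ∉ F) :
    X.L P v t - X.L P w t ≤ 2 * (P.c + 3) * P.δ * (augmented 𝒢 m).diam := by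
  have hδ := S.δ_ge
  have hδ0 := S.δ_pos
  have hE := S.adm.E_pos
  have hc := S.c_ge
  set D := (augmented 𝒢 m).diam with hD
  rcases eq_or_ne v w with rfl | hvw
  · rw [sub_self]
    exact mul_nonneg (mul_nonneg (by linarith) hδ0.le) (Nat.cast_nonneg D)
  have hD1 : (1 : ℝ) ≤ D := by exact_mod_cast (exists_walk_le_diam hconn v w).2 hvw
  have hδD : P.δ ≤ P.δ * D := le_mul_of_one_le_right hδ0.le hD1
  have hcδD : (P.c + 2) * P.δ ≤ (P.c + 2) * (P.δ * D) :=
    mul_le_mul_of_nonneg_left hδD (by linarith)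
  have hM : ∀ t, 0 ≤ t → ∀ v ∉ F, ∀ w ∉ F, X.L P w t ≤ X.M v t + P.δ * D := by
    intro t ht v hv w hw
    obtain ⟨p, hp⟩ := (exists_walk_le_diam hconn w v).1
    have h1 := S.L_le_M_add hv hw p ht
    have h2 : (p.length : ℝ) ≤ D := by exact_mod_cast hp
    have h3 : (2 * (p.length : ℝ) + 12) * P.E ≤ (14 * D) * P.E :=
      mul_le_mul_of_nonneg_right (by linarith) hE.le
    have h4 : (14 * P.E) * D ≤ P.δ * D := mul_le_mul_of_nonneg_right (by linarith) (by linarith)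
    linarith
  -- With lag `η = δ D`, a skew above `g` exceeds the threshold `η + (c + 2) δ` of `le_L_of_skew`,
  -- because `D ≥ 1`.
  set g := (P.c + 3) * (P.δ * D) with hg
  have hg0 : 0 ≤ g := mul_nonneg (by linarith) (by linarith)
  obtain ⟨a, ha, hsmall, hlarge⟩ := S.exists_last_small hg0 ht
  have : Nonempty {v : 𝒞 × Fin m // v ∉ F} := ⟨⟨v, hv⟩⟩
  obtain ⟨⟨u, hu⟩, hmax⟩ := Finite.exists_max fun v : {v : 𝒞 × Fin m // v ∉ F} => X.L P v.1 a
  obtain ⟨⟨l, hl⟩, hmin⟩ := Finite.exists_min fun v : {v : 𝒞 × Fin m // v ∉ F} => X.L P v.1 a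
  have h1 := S.L_le_of_M_le (fun t ht => S.M_le_L ht) ha.1 ha.2
    (B := X.L P u a - P.pace * a) (fun v hv => by linarith [hmax ⟨v, hv⟩]) v hv
  have h2 := S.le_L_of_skew hM ha.1 ha.2 (B := X.L P l a - P.pace * a)
    (fun v hv => by linarith [hmin ⟨v, hv⟩]) (fun τ h1 h2 => by
      obtain ⟨x, hx, y, hy, hxy⟩ := hlarge τ h1 h2
      exact ⟨x, hx, y, hy, by linarith⟩) w hw
  have h3 := hsmall u hu l hl
  -- The highest and the lowest clock each contribute at most `δ` after time `a`, and `g + 2 δ ≤ 2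
  -- g`.
  have h4 : 2 * P.δ ≤ (P.c + 3) * (P.δ * D) := by
    have : 1 * (P.δ * D) ≤ (P.c + 1) * (P.δ * D) :=
      mul_le_mul_of_nonneg_right (by linarith) (by linarith)
    linarith
  linarith

end Execution.Setup
end

end FTGCS

theorem mainTheorem7 (c₂ : ℝ) (hc₂ : 32 ≤ c₂) :
    ∃ ρ₀ : ℝ, 0 < ρ₀ ∧ ∃ (k₀ : ℕ) (c₀ : ℝ), ∀ k : ℕ, k₀ ≤ k → ∀ c : ℝ, c₀ ≤ c →
      ∃ K : ℝ, ∀ P : FTGCS.Params, P.c₂ = c₂ → P.k = k → P.c = c →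
        0 < P.ρ → P.ρ ≤ ρ₀ → 0 ≤ P.U → P.U < P.d →
        ∀ (𝒞 : Type*) [Fintype 𝒞] (𝒢 : SimpleGraph 𝒞), 𝒢.Connected →
        ∀ f m : ℕ, 3 * f + 1 ≤ m →
        ∀ F : Set (𝒞 × Fin m), (∀ C : 𝒞, {i : Fin m | (C, i) ∈ F}.ncard ≤ f) →
        ∀ X : FTGCS.Execution 𝒞 m, X.IsValid P 𝒢 f F →
        ∀ t : ℝ, 0 ≤ t → ∀ v ∉ F, ∀ w ∉ F,
          |X.L P v t - X.L P w t| ≤ K * P.δ * (FTGCS.augmented 𝒢 m).diam := by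
  -- The choice of `ρ₀` gives `ε ≤ 1/1000000`; `k ≥ 100` gives `δ ≥ 105 E`; `c ≥ 2` keeps leading
  -- nodes out of the catch-up rule.
  refine ⟨1 / 1000000 / (1 + c₂), by positivity, 100, 2, fun k hk c hc => ⟨2 * (c + 3), ?_⟩⟩
  rintro P rfl rfl rfl hρ hρ₀ hU hUd 𝒞 _ 𝒢 hconn f m hm F hF X hX t ht v hv w hw
  have hadm : P.Admissible :=
    ⟨hc₂, hρ, by rw [le_div_iff₀' (by linarith)] at hρ₀; exact hρ₀, hU, hUd⟩
  have S : FTGCS.Execution.Setup P 𝒢 f F X := ⟨hadm, hm, hF, hX, hk, hc⟩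
  exact abs_sub_le_iff.2 ⟨S.skew_le hconn ht hv hw, S.skew_le hconn ht hw hv⟩
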